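/- A three-player XOR game $G=(\pi,M)$ with $Q$ questions per player consists of a probability distribution $\pi$ on $[Q]^3$ and a sign tensor $M:[Q]^3\to\{\pm1\}$. Its classical bias is $$\beta(G)=\max_{\chi,\upsilon,\zeta:[Q]\to\{\pm1\}}\ \mathbb E_{(a,b,c)\sim\pi}\big[M(a,b,c)\,\chi(a)\upsilon(b)\zeta(c)\big].$$ An entangled strategy of local dimension $d$ consists of a unit vector $\psi\in\mathbb C^d\otimes\mathbb C^d\otimes\mathbb C^d$ and, for each player, a map $A_1,A_2,A_3$ from $[Q]$ to the $\pm1$-valued observables on $\mathbb C^d$ (Hermitian $d\times d$ matrices with all eigenvalues in $\{\pm1\}$); its bias is $\mathbb E_{(a,b,c)\sim\pi}\big[M(a,b,c)\,\langle\psi|A_1(a)\otimes A_2(b)\otimes A_3(c)|\psi\rangle\big]$. The entangled bias $\beta^*(G)$ is the supremum of the biases of all entangled strategies, over all $d\in\mathbb N$. **Theorem.** There is a universal constant $C>0$ such that for every integer $n\ge 1$, with $N=2^n$, there exists a three-player XOR game $G_N$ with $N^2$ questions per player such that $$\beta^*(G_N)\ \ge\ C\,\sqrt N\,(\log N)^{-5/2}\,\beta(G_N).$$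 Moreover, there is an entangled strategy for $G_N$ which has bias at least $C\sqrt N(\log N)^{-5/2}\beta(G_N)$, uses a state of local dimension $N$ per player, and in which every observable of every player is a tensor product of $n$ Pauli matrices (each factor being one of $I=\begin{pmatrix}1&0\\0&1\end{pmatrix}$, $X=\begin{pmatrix}0&1\\1&0\end{pmatrix}$, $Y=\begin{pmatrix}0&-i\\i&0\end{pmatrix}$, $Z=\begin{pmatrix}1&0\\0&-1\end{pmatrix}$). -/

import Mathlib

open scoped Matrix Kronecker

/-- A three-player XOR game with `Q` questions per player: a joint probability distribution `prob`
on triples of questions, and a sign for every triple of questions. -/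
structure XORGame (Q : ℕ) where
  prob : Fin Q → Fin Q → Fin Q → ℝ
  prob_nonneg : ∀ a b c, 0 ≤ prob a b c
  prob_sum : ∑ a, ∑ b, ∑ c, prob a b c = 1
  sign : Fin Q → Fin Q → Fin Q → ℤˣ

/-- The `±1`-valued observables on `ℂ^d`: Hermitian matrices with all eigenvalues in `{1, -1}`. -/
def IsObservable {d : ℕ} (A : Matrix (Fin d) (Fin d) ℂ) : Prop :=
  A.IsHermitian ∧ ∀ μ ∈ spectrum ℂ A, μ = 1 ∨ μ = -1

/-- An entangled strategy of local dimension `d` for three players with `Q` questions each: a unit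
vector in `ℂ^d ⊗ ℂ^d ⊗ ℂ^d` and, for each player, an observable for every question. -/
structure EntangledStrategy (Q d : ℕ) where
  state : EuclideanSpace ℂ (Fin d × Fin d × Fin d)
  norm_state : ‖state‖ = 1
  obs₁ : Fin Q → Matrix (Fin d) (Fin d) ℂ
  obs₂ : Fin Q → Matrix (Fin d) (Fin d) ℂ
  obs₃ : Fin Q → Matrix (Fin d) (Fin d) ℂ
  isObservable₁ : ∀ q, IsObservable (obs₁ q)
  isObservable₂ : ∀ q, IsObservable (obs₂ q)
  isObservable₃ : ∀ q, IsObservable (obs₃ q)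

namespace EntangledStrategy

/-- The expected product of the three answers, `⟨ψ| A(a) ⊗ B(b) ⊗ C(c) |ψ⟩`. The operator is
Hermitian, so this number is real; taking the real part only changes its type. -/
noncomputable def correlation {Q d : ℕ} (S : EntangledStrategy Q d) (a b c : Fin Q) : ℝ :=
  (star S.state.ofLp ⬝ᵥ ((S.obs₁ a ⊗ₖ (S.obs₂ b ⊗ₖ S.obs₃ c)) *ᵥ S.state.ofLp)).re

end EntangledStrategy

namespace XORGame

/-- The bias achieved by the deterministic classical strategies `χ`, `υ`, `ζ`. -/
noncomputable def classicalValue {Q : ℕ} (G : XORGame Q) (χ υ ζ : Fin Q → ℤˣ) : ℝ :=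
  ∑ a, ∑ b, ∑ c, G.prob a b c * ((G.sign a b c * (χ a * υ b * ζ c) : ℤˣ) : ℤ)

/-- The classical bias: the maximum over the (finitely many) classical strategies. -/
noncomputable def classicalBias {Q : ℕ} (G : XORGame Q) : ℝ :=
  ⨆ s : (Fin Q → ℤˣ) × (Fin Q → ℤˣ) × (Fin Q → ℤˣ), G.classicalValue s.1 s.2.1 s.2.2

/-- The bias achieved by an entangled strategy. -/
noncomputable def entangledValue {Q d : ℕ} (G : XORGame Q) (S : EntangledStrategy Q d) : ℝ :=
  ∑ a, ∑ b, ∑ c, G.prob a b c * ((G.sign a b c : ℤˣ) : ℤ) * S.correlation a b c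

/-- The entangled bias: the supremum over all entangled strategies of any finite local dimension.
All these values lie in `[-1, 1]`. -/
noncomputable def entangledBias {Q : ℕ} (G : XORGame Q) : ℝ :=
  sSup {b : ℝ | ∃ (d : ℕ) (S : EntangledStrategy Q d), b = G.entangledValue S}

end XORGame

/-- The four Pauli matrices `I`, `X`, `Y`, `Z`. -/
def pauliMatrix : Fin 4 → Matrix (Fin 2) (Fin 2) ℂ :=
  ![!![1, 0; 0, 1], !![0, 1; 1, 0], !![0, -Complex.I; Complex.I, 0], !![1, 0; 0, -1]]

/-- The tensor product of the Pauli matrices `s 0, …, s (n - 1)`, as a `2 ^ n × 2 ^ n` matrix: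
indices in `Fin (2 ^ n)` are read as sequences of `n` binary digits. -/
def pauliString {n : ℕ} (s : Fin n → Fin 4) : Matrix (Fin (2 ^ n)) (Fin (2 ^ n)) ℂ :=
  Matrix.of fun x y =>
    ∏ k, pauliMatrix (s k) (finFunctionFinEquiv.symm x k) (finFunctionFinEquiv.symm y k)

/-- The set of `n`-fold tensor products of Pauli matrices. -/
def pauliStrings (n : ℕ) : Set (Matrix (Fin (2 ^ n)) (Fin (2 ^ n)) ℂ) :=
  Set.range pauliString

/-! Put N = 2K and split the basis of ℂ^N into halves A and B of size K. The construction rests on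
two sign tensors g, h with K³ entries for which T(X, Y, Z) = ⟨g, (X ⊗ Y ⊗ Z) h⟩ is at most
β‖X‖‖Y‖‖Z‖ in Frobenius norms, with β of order K n^(5/2) (`exists_sign_tensors_froNorm_le`).
Questions are Pauli strings, and the signed weight of (s, t, u) is proportional to the real part of
T at the A-B blocks of P_s, P_t, P_u.

The entangled players share the unit vector proportional to g on A³ plus h on B³ and measure the
Pauli strings they are asked. Completeness of the Paulis collapses their unnormalised score to
N³K³/2 (`sum_cForm_mul_expectation`). Classical signs χ turn the score into T at matrices ∑ χ(s)
P_s, whose Frobenius norm is exactly N^(3/2) by orthogonality, so the score is at most 4βN^(9/2)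
(`re_cForm_le`). The quotient has order √N n^(-5/2).

To bound T, cut each argument along its singular values into n pieces of dyadic rank
(`exists_dyadic_decomposition`). Pieces of ranks p, q, r factor through K×p, K×q, K×r matrices, so
nets of dimension K(p+q+r) suffice instead of K². Hoeffding's inequality with a union bound, first
for g and then for h given g, yields `exists_sign_tensors_form_le`. This is good enough when no rank
exceeds ρ times the product of the other two (`sqrt_balanced_le`). If, say, p > ρqr, then
contracting g with the factors of Y and Z leaves at most qr directions, and X can be projected onto
them (`abs_triForm_mul_transpose_le`). Such triples contribute O(n/√ρ) times β itself, and ρ of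
order n² makes this β/2, which is absorbed. The exponent 5/2 is 3/2 from Cauchy–Schwarz over the
scales of three arguments, plus 1 from √ρ. -/

section SpectralNorm

open scoped Matrix.Norms.L2Operator

/-! ### Nets for linear functionals -/

/-- A finite set of vectors of norm at most two that controls every linear functional. -/
theorem exists_norming_finset (E : Type*) [NormedAddCommGroup E] [NormedSpace ℝ E]
    [FiniteDimensional ℝ E] :
    ∃ s : Finset E, s.card ≤ 5 ^ Module.finrank ℝ E ∧ (∀ c ∈ s, ‖c‖ ≤ 2) ∧
      ∀ (f : E →ₗ[ℝ] ℝ) (B : ℝ), (∀ c ∈ s, |f c| ≤ B) → ∀ x, |f x| ≤ B * ‖x‖ := by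
  classical
  -- The set is a maximal 1-separated subset of the ball of radius 2; maximality makes it a 1-net of
  -- that ball.
  let P : Finset E → Prop := fun s => (∀ c ∈ s, ‖c‖ ≤ 2) ∧
    ∀ c ∈ s, ∀ d ∈ s, c ≠ d → 1 ≤ ‖c - d‖
  have hP : ∀ s, P s → s.card ≤ 5 ^ Module.finrank ℝ E := fun s hs =>
    Besicovitch.card_le_of_separated s hs.1 hs.2
  obtain ⟨s, hs, hmax⟩ : ∃ s, P s ∧ ∀ s', P s' → s'.card ≤ s.card := by
    have hb : BddAbove {k | ∃ s, P s ∧ s.card = k} :=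
      ⟨5 ^ Module.finrank ℝ E, by rintro k ⟨s, hs, rfl⟩; exact hP s hs⟩
    have hne : {k | ∃ s, P s ∧ s.card = k}.Nonempty := ⟨0, ∅, by simp [P], by simp⟩
    obtain ⟨s, hs, h⟩ := Nat.sSup_mem hne hb
    refine ⟨s, hs, fun s' hs' => ?_⟩
    rw [h]
    exact le_csSup hb ⟨s', hs', rfl⟩
  have hnet : ∀ x : E, ‖x‖ ≤ 2 → ∃ c ∈ s, ‖x - c‖ ≤ 1 := by
    intro x hx
    by_contra! hcon
    have hxs : x ∉ s := fun h => by
      have := hcon x h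
      simp at this
      linarith
    have := hmax (insert x s) ⟨by simpa [hx] using hs.1, by
      intro c hc d hd hcd
      rw [Finset.mem_insert] at hc hd
      rcases hc with rfl | hc <;> rcases hd with rfl | hd
      · exact absurd rfl hcd
      · exact (hcon d hd).le
      · rw [norm_sub_rev]; exact (hcon c hc).le
      · exact hs.2 c hc d hd hcd⟩
    rw [Finset.card_insert_of_notMem hxs] at this
    omega
  refine ⟨s, hP s hs, hs.1, fun f B hB => ?_⟩
  set F : E →L[ℝ] ℝ := LinearMap.toContinuousLinearMap f with hF
  have hFf : ∀ x, F x = f x := fun x => rfl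
  have hB0 : 0 ≤ B := by
    obtain ⟨c, hc, -⟩ := hnet 0 (by simp)
    exact (abs_nonneg _).trans (hB c hc)
  have h2 : ∀ x : E, ‖x‖ ≤ 2 → |f x| ≤ B + ‖F‖ := by
    intro x hx
    obtain ⟨c, hc, hxc⟩ := hnet x hx
    have h1 : f x = f c + F (x - c) := by rw [hFf, map_sub]; ring
    have h3 : |F (x - c)| ≤ ‖F‖ * 1 := (F.le_opNorm _).trans (by gcongr)
    rw [h1]
    exact (abs_add_le _ _).trans (add_le_add (hB c hc) (by simpa using h3))
  -- Radius 2 against mesh 1 gives 2‖F‖ ≤ B + ‖F‖, so the net determines the norm without losing a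
  -- constant.
  have h4 : ‖F‖ ≤ (B + ‖F‖) / 2 := by
    refine F.opNorm_le_bound (by positivity) fun x => ?_
    by_cases hx : x = 0
    · simp [hx]
    have hx' : 0 < ‖x‖ := norm_pos_iff.2 hx
    have := h2 ((2 / ‖x‖) • x) (by
      rw [norm_smul, Real.norm_of_nonneg (by positivity)]
      field_simp; rfl)
    rw [map_smul, smul_eq_mul, abs_mul, abs_of_nonneg (by positivity : 0 ≤ 2 / ‖x‖)] at this
    rw [Real.norm_eq_abs, hFf]
    field_simp at this ⊢
    linarith
  intro x
  have h5 : ‖F‖ ≤ B := by linarith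
  exact (F.le_opNorm x).trans (by gcongr)

/-- A chosen norming finite set. -/
noncomputable def normingFinset (E : Type*) [NormedAddCommGroup E] [NormedSpace ℝ E]
    [FiniteDimensional ℝ E] : Finset E := (exists_norming_finset E).choose

section normingFinset

variable {E : Type*} [NormedAddCommGroup E] [NormedSpace ℝ E] [FiniteDimensional ℝ E]

theorem card_normingFinset_le : (normingFinset E).card ≤ 5 ^ Module.finrank ℝ E :=
  (exists_norming_finset E).choose_spec.1

theorem norm_le_of_mem_normingFinset {c : E} (hc : c ∈ normingFinset E) : ‖c‖ ≤ 2 :=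
  (exists_norming_finset E).choose_spec.2.1 c hc

theorem abs_le_of_normingFinset (f : E →ₗ[ℝ] ℝ) {B : ℝ}
    (hB : ∀ c ∈ normingFinset E, |f c| ≤ B) (x : E) : |f x| ≤ B * ‖x‖ :=
  (exists_norming_finset E).choose_spec.2.2 f B hB x

end normingFinset

/-! ### Hoeffding's inequality for sign vectors -/

theorem sum_exp_signs_le {κ : Type*} [Fintype κ] [DecidableEq κ] (u : κ → ℝ) (l : ℝ) :
    ∑ g ∈ Fintype.piFinset fun _ : κ => ({1, -1} : Finset ℝ), Real.exp (l * (g ⬝ᵥ u)) ≤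
      2 ^ Fintype.card κ * Real.exp (l ^ 2 * (u ⬝ᵥ u) / 2) := by
  have h1 : ∀ g : κ → ℝ, Real.exp (l * (g ⬝ᵥ u)) = ∏ j, Real.exp (l * (g j * u j)) := by
    intro g
    rw [dotProduct, Finset.mul_sum, Real.exp_sum]
  simp_rw [h1]
  rw [← Finset.prod_univ_sum (fun _ : κ => ({1, -1} : Finset ℝ))
    (fun j x => Real.exp (l * (x * u j)))]
  have h2 : l ^ 2 * (u ⬝ᵥ u) / 2 = ∑ j, (l * u j) ^ 2 / 2 := by
    rw [dotProduct, Finset.mul_sum, Finset.sum_div]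
    exact Finset.sum_congr rfl fun j _ => by ring
  rw [h2, Real.exp_sum, ← Finset.card_univ, ← Finset.prod_const, ← Finset.prod_mul_distrib]
  refine Finset.prod_le_prod (fun j _ => Finset.sum_nonneg fun _ _ => (Real.exp_pos _).le)
    fun j _ => ?_
  rw [Finset.sum_pair (by norm_num)]
  -- The two signs of one coordinate sum to 2 cosh(l u_j).
  have := Real.cosh_le_exp_half_sq (l * u j)
  rw [Real.cosh_eq] at this
  simp only [one_mul, neg_mul, mul_neg]
  linarith

theorem card_piFinset_signs {κ : Type*} [Fintype κ] [DecidableEq κ] :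
    (Fintype.piFinset fun _ : κ => ({1, -1} : Finset ℝ)).card = 2 ^ Fintype.card κ := by
  rw [Fintype.card_piFinset]
  simp [Finset.card_pair (show (1 : ℝ) ≠ -1 by norm_num)]

/-- Hoeffding's inequality with a union bound: one sign vector is nearly orthogonal to all vectors
of a finite union of finite families. -/
theorem exists_signs_forall_abs_dotProduct_le {κ T : Type*} [Fintype κ] [Fintype T]
    (s : T → Type*) [∀ τ, Fintype (s τ)] (u : ∀ τ, s τ → κ → ℝ) (D : T → ℕ) (σ : T → ℝ)
    (hσ : ∀ τ, 0 < σ τ) (hu : ∀ τ i, u τ i ⬝ᵥ u τ i ≤ σ τ ^ 2)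
    (hs : ∀ τ, Fintype.card (s τ) ≤ 5 ^ D τ) (hT : ∀ τ, 2 * Fintype.card T < 4 ^ D τ) :
    ∃ g : κ → ℝ, (∀ j, g j = 1 ∨ g j = -1) ∧ ∀ τ i, |g ⬝ᵥ u τ i| ≤ 3 * √(D τ) * σ τ := by
  classical
  set Ω := Fintype.piFinset fun _ : κ => ({1, -1} : Finset ℝ) with hΩ
  have hmem : ∀ g ∈ Ω, ∀ j, g j = 1 ∨ g j = -1 := by
    intro g hg j
    have := Fintype.mem_piFinset.1 hg j
    simpa using this
  -- This l minimises l²σ²/2 - l · 3√D σ, the Chernoff exponent at the claimed deviation; the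
  -- minimum is -9D/2.
  set l : T → ℝ := fun τ => 3 * √(D τ) / σ τ with hl
  -- A single violated inequality forces F ≥ 1, so a sign vector with F < 1 suffices, and one exists
  -- if the average of F is below 1.
  set F : (κ → ℝ) → ℝ := fun g => ∑ τ, ∑ i, Real.exp (-(9 * D τ)) *
    (Real.exp (l τ * (g ⬝ᵥ u τ i)) + Real.exp ((-l τ) * (g ⬝ᵥ u τ i))) with hFdef
  have hcard : (Ω.card : ℝ) = 2 ^ Fintype.card κ := by
    rw [hΩ, card_piFinset_signs]; norm_cast
  -- 20 = 5 · 4: the factor 5^D pays for the union over a family, and the remaining 4^(-D) for the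
  -- union over T.
  have he : (20 : ℝ) ≤ Real.exp (9 / 2) := by
    have h1 := Real.add_one_le_exp (9 / 8 : ℝ)
    have h2 : Real.exp (9 / 2) = Real.exp (9 / 8) ^ 4 := by
      rw [← Real.exp_nat_mul]; norm_num
    rw [h2]
    have h3 : (17 / 8 : ℝ) ≤ Real.exp (9 / 8) := by linarith
    calc (20 : ℝ) ≤ (17 / 8) ^ 4 := by norm_num
      _ ≤ _ := by gcongr
  have hsum : ∑ g ∈ Ω, F g ≤ (Ω.card : ℝ) * ∑ τ, 2 * ((4 : ℝ) ^ D τ)⁻¹ := by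
    rw [hFdef, Finset.sum_comm, Finset.mul_sum]
    refine Finset.sum_le_sum fun τ _ => ?_
    rw [Finset.sum_comm]
    have hl2 : l τ ^ 2 * σ τ ^ 2 / 2 = 9 / 2 * D τ := by
      have := hσ τ
      rw [hl]
      field_simp
      rw [Real.sq_sqrt (by positivity)]; norm_num
    have hi : ∀ i, ∑ g ∈ Ω, Real.exp (-(9 * D τ)) *
        (Real.exp (l τ * (g ⬝ᵥ u τ i)) + Real.exp ((-l τ) * (g ⬝ᵥ u τ i))) ≤
        (Ω.card : ℝ) * (2 * Real.exp (-(9 / 2 * D τ))) := by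
      intro i
      rw [← Finset.mul_sum, Finset.sum_add_distrib]
      have h1 := sum_exp_signs_le (u τ i) (l τ)
      have h2 := sum_exp_signs_le (u τ i) (-l τ)
      rw [neg_sq] at h2
      have h3 : Real.exp (l τ ^ 2 * (u τ i ⬝ᵥ u τ i) / 2) ≤ Real.exp (9 / 2 * D τ) := by
        rw [← hl2]
        gcongr
        exact hu τ i
      rw [hcard]
      have h4 : Real.exp (-(9 / 2 * D τ)) = Real.exp (-(9 * D τ)) * Real.exp (9 / 2 * D τ) := by
        rw [← Real.exp_add]; congr 1; ring
      rw [h4]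
      have h5 : (0 : ℝ) ≤ 2 ^ Fintype.card κ := by positivity
      calc _ ≤ Real.exp (-(9 * D τ)) * (2 ^ Fintype.card κ * Real.exp (9 / 2 * D τ) +
            2 ^ Fintype.card κ * Real.exp (9 / 2 * D τ)) := by
            gcongr
            · exact h1.trans (by gcongr)
            · exact h2.trans (by gcongr)
        _ = _ := by ring
    calc _ ≤ ∑ i : s τ, (Ω.card : ℝ) * (2 * Real.exp (-(9 / 2 * D τ))) :=
          Finset.sum_le_sum fun i _ => hi i
      _ = (Ω.card : ℝ) * (2 * (Fintype.card (s τ) * Real.exp (-(9 / 2 * D τ)))) := by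
          rw [Finset.sum_const, Finset.card_univ, nsmul_eq_mul]; ring
      _ ≤ _ := by
          gcongr
          have h6 : Real.exp (-(9 / 2 * D τ)) ≤ ((20 : ℝ) ^ D τ)⁻¹ := by
            rw [Real.exp_neg, mul_comm (9 / 2 : ℝ), Real.exp_nat_mul]
            gcongr
          have h7 : (Fintype.card (s τ) : ℝ) ≤ 5 ^ D τ := by exact_mod_cast hs τ
          calc _ ≤ (5 : ℝ) ^ D τ * ((20 : ℝ) ^ D τ)⁻¹ := by gcongr
            _ = _ := by
              rw [← inv_pow, ← inv_pow, ← mul_pow]; norm_num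
  obtain ⟨g, hg, hFg⟩ : ∃ g ∈ Ω, F g < 1 := by
    by_contra! hcon
    have h1 : (Ω.card : ℝ) ≤ ∑ g ∈ Ω, F g := by
      simpa using Finset.card_nsmul_le_sum Ω F 1 hcon
    have hpos : (0 : ℝ) < Ω.card := by rw [hcard]; positivity
    have h2 : ∑ τ, 2 * ((4 : ℝ) ^ D τ)⁻¹ < 1 := by
      rcases isEmpty_or_nonempty T with hT0 | hT0
      · simp
      · have hTp : (0 : ℝ) < Fintype.card T := by exact_mod_cast Fintype.card_pos
        calc _ < ∑ τ : T, (1 : ℝ) / Fintype.card T := by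
              refine Finset.sum_lt_sum_of_nonempty Finset.univ_nonempty fun τ _ => ?_
              have : (2 * Fintype.card T : ℝ) < 4 ^ D τ := by exact_mod_cast hT τ
              rw [lt_div_iff₀ hTp, mul_right_comm, ← div_eq_mul_inv, div_lt_one (by positivity)]
              exact this
          _ = 1 := by
              rw [Finset.sum_const, Finset.card_univ, nsmul_eq_mul]; field_simp
    have h3 := h1.trans hsum
    nlinarith
  refine ⟨g, hmem g hg, fun τ i => ?_⟩
  by_contra! hcon
  have hterm : Real.exp (-(9 * D τ)) *
      (Real.exp (l τ * (g ⬝ᵥ u τ i)) + Real.exp ((-l τ) * (g ⬝ᵥ u τ i))) ≤ F g := by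
    refine le_trans ?_ (Finset.single_le_sum
      (f := fun τ => ∑ i, Real.exp (-(9 * D τ)) *
        (Real.exp (l τ * (g ⬝ᵥ u τ i)) + Real.exp ((-l τ) * (g ⬝ᵥ u τ i))))
      (fun _ _ => by positivity) (Finset.mem_univ τ))
    exact Finset.single_le_sum (f := fun i => Real.exp (-(9 * D τ)) *
        (Real.exp (l τ * (g ⬝ᵥ u τ i)) + Real.exp ((-l τ) * (g ⬝ᵥ u τ i))))
      (fun _ _ => by positivity) (Finset.mem_univ i)
  have hlt : 9 * (D τ : ℝ) = l τ * (3 * √(D τ) * σ τ) := by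
    have := hσ τ
    rw [hl]; field_simp; rw [Real.sq_sqrt (by positivity)]; norm_num
  have hl0 : 0 ≤ l τ := by have := hσ τ; rw [hl]; positivity
  have hbig : 9 * (D τ : ℝ) ≤ |l τ * (g ⬝ᵥ u τ i)| := by
    rw [hlt, abs_mul, abs_of_nonneg hl0]
    gcongr
  have hexp : Real.exp (9 * D τ) ≤
      Real.exp (l τ * (g ⬝ᵥ u τ i)) + Real.exp ((-l τ) * (g ⬝ᵥ u τ i)) := by
    rcases abs_cases (l τ * (g ⬝ᵥ u τ i)) with h | h
    · exact (Real.exp_le_exp.2 (h.1 ▸ hbig)).trans (le_add_of_nonneg_right (Real.exp_pos _).le)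
    · rw [neg_mul]
      exact (Real.exp_le_exp.2 (h.1 ▸ hbig)).trans (le_add_of_nonneg_left (Real.exp_pos _).le)
  have : 1 ≤ F g := by
    refine le_trans ?_ hterm
    calc (1 : ℝ) = Real.exp (-(9 * D τ)) * Real.exp (9 * D τ) := by
          rw [← Real.exp_add]; simp
      _ ≤ _ := by gcongr
  linarith

/-! ### Operator norms of real matrices and Kronecker products -/

section opNorm

variable {m n p q : Type*} [Fintype m] [Fintype n] [DecidableEq n] [Fintype p] [Fintype q]
  [DecidableEq q]

theorem Matrix.mulVec_dotProduct_self_le (A : Matrix m n ℝ) (x : n → ℝ) :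
    (A *ᵥ x) ⬝ᵥ (A *ᵥ x) ≤ ‖A‖ ^ 2 * (x ⬝ᵥ x) := by
  have h := A.l2_opNorm_mulVec (WithLp.toLp 2 x)
  have h2 := pow_le_pow_left₀ (norm_nonneg _) h 2
  rw [mul_pow, EuclideanSpace.norm_sq_eq, EuclideanSpace.norm_sq_eq] at h2
  simpa [dotProduct, ← sq] using h2

theorem Matrix.l2_opNorm_le_of_dotProduct {A : Matrix m n ℝ} {c : ℝ} (hc : 0 ≤ c)
    (h : ∀ x, (A *ᵥ x) ⬝ᵥ (A *ᵥ x) ≤ c ^ 2 * (x ⬝ᵥ x)) : ‖A‖ ≤ c := by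
  rw [Matrix.l2_opNorm_def]
  refine ContinuousLinearMap.opNorm_le_bound _ hc fun x => ?_
  refine le_of_sq_le_sq ?_ (by positivity)
  rw [mul_pow, EuclideanSpace.norm_sq_eq, EuclideanSpace.norm_sq_eq]
  simpa [dotProduct, ← sq] using h x.ofLp

theorem Matrix.l2_opNorm_transpose [DecidableEq m] (A : Matrix m n ℝ) : ‖Aᵀ‖ = ‖A‖ := by
  rw [← Matrix.l2_opNorm_conjTranspose A, Matrix.conjTranspose_eq_transpose_of_trivial]

/-- A ⊗ B acts by B on one index and then by A on the other; each action costs its norm on every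
slice. -/
theorem Matrix.l2_opNorm_kronecker_le (A : Matrix m n ℝ) (B : Matrix p q ℝ) :
    ‖A ⊗ₖ B‖ ≤ ‖A‖ * ‖B‖ := by
  refine Matrix.l2_opNorm_le_of_dotProduct (by positivity) fun x => ?_
  have h1 : ∀ i j, ((A ⊗ₖ B) *ᵥ x) (i, j) = (A *ᵥ fun a => (B *ᵥ fun b => x (a, b)) j) i := by
    intro i j
    simp only [Matrix.mulVec, dotProduct, Fintype.sum_prod_type, Matrix.kronecker_apply,
      Finset.mul_sum, mul_assoc]
  calc ((A ⊗ₖ B) *ᵥ x) ⬝ᵥ ((A ⊗ₖ B) *ᵥ x)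
      = ∑ j, (A *ᵥ fun a => (B *ᵥ fun b => x (a, b)) j) ⬝ᵥ
          (A *ᵥ fun a => (B *ᵥ fun b => x (a, b)) j) := by
        simp only [dotProduct, Fintype.sum_prod_type, h1]
        exact Finset.sum_comm
    _ ≤ ∑ j, ‖A‖ ^ 2 * ((fun a => (B *ᵥ fun b => x (a, b)) j) ⬝ᵥ
          fun a => (B *ᵥ fun b => x (a, b)) j) :=
        Finset.sum_le_sum fun j _ => A.mulVec_dotProduct_self_le _
    _ = ‖A‖ ^ 2 * ∑ a, (B *ᵥ fun b => x (a, b)) ⬝ᵥ (B *ᵥ fun b => x (a, b)) := by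
        rw [← Finset.mul_sum]
        simp only [dotProduct]
        rw [Finset.sum_comm]
    _ ≤ ‖A‖ ^ 2 * ∑ a, ‖B‖ ^ 2 * ((fun b => x (a, b)) ⬝ᵥ fun b => x (a, b)) := by
        gcongr
        exact B.mulVec_dotProduct_self_le _
    _ = _ := by
        rw [← Finset.mul_sum]
        simp only [dotProduct, Fintype.sum_prod_type]
        ring

end opNorm

theorem IsLinearMap.abs_le_of_normingFinset {E : Type*} [NormedAddCommGroup E] [NormedSpace ℝ E]
    [FiniteDimensional ℝ E] {f : E → ℝ} (hf : IsLinearMap ℝ f) {B : ℝ}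
    (hB : ∀ c ∈ normingFinset E, |f c| ≤ B) (x : E) : |f x| ≤ B * ‖x‖ :=
  _root_.abs_le_of_normingFinset hf.mk' hB x

/-- The threefold Kronecker product. -/
def kron₃ {R l₁ l₂ l₃ m₁ m₂ m₃ : Type*} [Mul R] (U : Matrix l₁ m₁ R) (V : Matrix l₂ m₂ R)
    (W : Matrix l₃ m₃ R) : Matrix (l₁ × l₂ × l₃) (m₁ × m₂ × m₃) R :=
  U ⊗ₖ (V ⊗ₖ W)

section kron₃

variable {l₁ l₂ l₃ m₁ m₂ m₃ : Type*}
  (U U' : Matrix l₁ m₁ ℝ) (V V' : Matrix l₂ m₂ ℝ) (W W' : Matrix l₃ m₃ ℝ) (c : ℝ)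

theorem kron₃_add₁ : kron₃ (U + U') V W = kron₃ U V W + kron₃ U' V W := by
  simp [kron₃, Matrix.add_kronecker]

theorem kron₃_add₂ : kron₃ U (V + V') W = kron₃ U V W + kron₃ U V' W := by
  simp [kron₃, Matrix.add_kronecker, Matrix.kronecker_add]

theorem kron₃_add₃ : kron₃ U V (W + W') = kron₃ U V W + kron₃ U V W' := by
  simp [kron₃, Matrix.kronecker_add]

theorem kron₃_smul₁ : kron₃ (c • U) V W = c • kron₃ U V W := by
  simp [kron₃, Matrix.smul_kronecker]

theorem kron₃_smul₂ : kron₃ U (c • V) W = c • kron₃ U V W := by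
  simp [kron₃, Matrix.smul_kronecker, Matrix.kronecker_smul]

theorem kron₃_smul₃ : kron₃ U V (c • W) = c • kron₃ U V W := by
  simp [kron₃, Matrix.kronecker_smul]

theorem kron₃_transpose : (kron₃ U V W)ᵀ = kron₃ Uᵀ Vᵀ Wᵀ := rfl

theorem kron₃_mul [Fintype m₁] [Fintype m₂] [Fintype m₃] {n₁ n₂ n₃ : Type*} (U' : Matrix m₁ n₁ ℝ)
    (V' : Matrix m₂ n₂ ℝ) (W' : Matrix m₃ n₃ ℝ) :
    kron₃ U V W * kron₃ U' V' W' = kron₃ (U * U') (V * V') (W * W') := by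
  simp [kron₃, Matrix.mul_kronecker_mul]

theorem l2_opNorm_kron₃_le [Fintype l₁] [Fintype l₂] [Fintype l₃] [Fintype m₁] [Fintype m₂]
    [Fintype m₃] [DecidableEq m₁] [DecidableEq m₂] [DecidableEq m₃] :
    ‖kron₃ U V W‖ ≤ ‖U‖ * ‖V‖ * ‖W‖ := by
  refine (Matrix.l2_opNorm_kronecker_le _ _).trans ?_
  rw [mul_assoc]
  gcongr
  exact Matrix.l2_opNorm_kronecker_le _ _

end kron₃

theorem dotProduct_self_nonneg {n : Type*} [Fintype n] (x : n → ℝ) : 0 ≤ x ⬝ᵥ x :=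
  Finset.sum_nonneg fun i _ => mul_self_nonneg (x i)

theorem Matrix.dotProduct_mulVec_transpose {m n : Type*} [Fintype m] [Fintype n]
    (A : Matrix m n ℝ) (x : m → ℝ) (y : n → ℝ) : x ⬝ᵥ (A *ᵥ y) = (Aᵀ *ᵥ x) ⬝ᵥ y := by
  rw [Matrix.dotProduct_mulVec, Matrix.mulVec_transpose]

theorem Matrix.mulVec_dotProduct_self_le_of_norm_le {m n : Type*} [Fintype m] [Fintype n]
    [DecidableEq n] {A : Matrix m n ℝ} {x : n → ℝ} {r t : ℝ} (hA : ‖A‖ ≤ r)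
    (hx : x ⬝ᵥ x ≤ t ^ 2) : (A *ᵥ x) ⬝ᵥ (A *ᵥ x) ≤ (r * t) ^ 2 := by
  refine (A.mulVec_dotProduct_self_le x).trans ?_
  rw [mul_pow]
  gcongr
  exact dotProduct_self_nonneg x

/-! ### Random sign tensors against low-rank matrices -/

theorem two_mul_pow_three_lt (m K D : ℕ) (hK : K = 2 ^ m) (hD : 3 * K ≤ D) :
    2 * ((m + 1) * ((m + 1) * (m + 1))) < 4 ^ D := by
  have h1 : m + 1 ≤ K := hK ▸ Nat.lt_two_pow_self
  have h2 : m + 1 < 2 ^ (m + 1) := Nat.lt_two_pow_self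
  have h3 : 4 ^ (3 * (m + 1)) ≤ 4 ^ D := Nat.pow_le_pow_right (by norm_num) (by omega)
  refine lt_of_lt_of_le ?_ h3
  have h4 : 4 ^ (3 * (m + 1)) = (2 ^ (m + 1)) ^ 3 * (2 ^ (m + 1)) ^ 3 := by
    rw [← pow_mul, ← pow_add, show 4 = 2 ^ 2 by norm_num, ← pow_mul]
    congr 1; ring
  rw [h4]
  have h5 : (m + 1) ^ 3 < (2 ^ (m + 1)) ^ 3 := Nat.pow_lt_pow_left h2 (by norm_num)
  have h6 : 2 ≤ (2 ^ (m + 1)) ^ 3 := by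
    rw [← pow_mul]
    calc 2 = 2 ^ 1 := by norm_num
      _ ≤ _ := Nat.pow_le_pow_right (by norm_num) (by omega)
  nlinarith

/-- A sign tensor all of whose contractions with matrices of small operator norm are small. -/
theorem exists_sign_tensor_contraction_le (m : ℕ) {K : ℕ} (hK : K = 2 ^ m) :
    ∃ g : Fin K × Fin K × Fin K → ℝ, (∀ j, g j = 1 ∨ g j = -1) ∧
      ∀ a b c : Fin (m + 1), ∀ (U : Matrix (Fin K) (Fin (2 ^ (a : ℕ))) ℝ)
        (V : Matrix (Fin K) (Fin (2 ^ (b : ℕ))) ℝ) (W : Matrix (Fin K) (Fin (2 ^ (c : ℕ))) ℝ),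
        ((kron₃ U V W)ᵀ *ᵥ g) ⬝ᵥ ((kron₃ U V W)ᵀ *ᵥ g) ≤
          (48 * √((K * (2 ^ (a : ℕ) + 2 ^ (b : ℕ) + 2 ^ (c : ℕ)) +
            2 ^ (a : ℕ) * (2 ^ (b : ℕ) * 2 ^ (c : ℕ)) : ℕ) : ℝ) * (‖U‖ * ‖V‖ * ‖W‖)) ^ 2 := by
  let T := Fin (m + 1) × Fin (m + 1) × Fin (m + 1)
  let s : T → Type := fun τ =>
    normingFinset (Matrix (Fin K) (Fin (2 ^ (τ.1 : ℕ))) ℝ) ×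
    normingFinset (Matrix (Fin K) (Fin (2 ^ (τ.2.1 : ℕ))) ℝ) ×
    normingFinset (Matrix (Fin K) (Fin (2 ^ (τ.2.2 : ℕ))) ℝ) × normingFinset (EuclideanSpace ℝ
    (Fin (2 ^ (τ.1 : ℕ)) × Fin (2 ^ (τ.2.1 : ℕ)) × Fin (2 ^ (τ.2.2 : ℕ))))
  -- The dimensions of U, V, W, plus that of a test vector x which turns the norm of the contraction
  -- into a linear quantity.
  let D : T → ℕ := fun τ => K * (2 ^ (τ.1 : ℕ) + 2 ^ (τ.2.1 : ℕ) + 2 ^ (τ.2.2 : ℕ)) +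
            2 ^ (τ.1 : ℕ) * (2 ^ (τ.2.1 : ℕ) * 2 ^ (τ.2.2 : ℕ))
  obtain ⟨g, hg, h⟩ := exists_signs_forall_abs_dotProduct_le s
    (fun τ i => kron₃ i.1.1 i.2.1.1 i.2.2.1.1 *ᵥ (i.2.2.2.1 : EuclideanSpace ℝ _).ofLp) D
    -- Four net elements of norm at most 2 each give 16, and Hoeffding's factor 3 gives the 48 of
    -- the statement.
    (fun _ => 16) (fun _ => by norm_num) (by
      rintro τ ⟨⟨U, hU⟩, ⟨V, hV⟩, ⟨W, hW⟩, ⟨x, hx⟩⟩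
      have h1 : ‖kron₃ U V W‖ ≤ 2 * 2 * 2 := by
        refine (l2_opNorm_kron₃_le U V W).trans ?_
        have := norm_le_of_mem_normingFinset hU
        have := norm_le_of_mem_normingFinset hV
        have := norm_le_of_mem_normingFinset hW
        gcongr
      have h2 : x.ofLp ⬝ᵥ x.ofLp ≤ 2 ^ 2 := by
        have h3 := pow_le_pow_left₀ (norm_nonneg _) (norm_le_of_mem_normingFinset hx) 2
        rw [EuclideanSpace.norm_sq_eq] at h3
        simpa [dotProduct, ← sq] using h3
      refine (Matrix.mulVec_dotProduct_self_le_of_norm_le h1 h2).trans (by norm_num)) (by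
      intro τ
      simp only [s, Fintype.card_prod, Fintype.card_coe]
      have h1 := card_normingFinset_le (E := Matrix (Fin K) (Fin (2 ^ (τ.1 : ℕ))) ℝ)
      have h2 := card_normingFinset_le (E := Matrix (Fin K) (Fin (2 ^ (τ.2.1 : ℕ))) ℝ)
      have h3 := card_normingFinset_le (E := Matrix (Fin K) (Fin (2 ^ (τ.2.2 : ℕ))) ℝ)
      have h4 := card_normingFinset_le (E := EuclideanSpace ℝ
        (Fin (2 ^ (τ.1 : ℕ)) × Fin (2 ^ (τ.2.1 : ℕ)) × Fin (2 ^ (τ.2.2 : ℕ))))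
      simp only [Module.finrank_matrix, Module.finrank_self, Fintype.card_fin, mul_one,
        finrank_euclideanSpace, Fintype.card_prod] at h1 h2 h3 h4
      calc _ ≤ _ := Nat.mul_le_mul h1 (Nat.mul_le_mul h2 (Nat.mul_le_mul h3 h4))
        _ = _ := by
          rw [← pow_add, ← pow_add, ← pow_add]
          congr 1
          simp only [D]; ring) (by
      intro τ
      simp only [T, Fintype.card_prod, Fintype.card_fin]
      -- The union runs over all (m+1)³ triples of dyadic ranks.
      refine two_mul_pow_three_lt m K _ hK ?_
      have h1 := Nat.one_le_two_pow (n := (τ.1 : ℕ))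
      have h2 := Nat.one_le_two_pow (n := (τ.2.1 : ℕ))
      have h3 := Nat.one_le_two_pow (n := (τ.2.2 : ℕ))
      have h4 := Nat.mul_le_mul_left K (add_le_add (add_le_add h1 h2) h3)
      simp only [D]
      omega)
  refine ⟨g, hg, fun a b c U V W => ?_⟩
  set B : ℝ := 3 * √(D (a, b, c)) * 16 with hB
  -- The pairing is linear in each of U, V, W, x separately, so the passage from net elements to all
  -- arguments is made one variable at a time.
  have key : ∀ U V W (x : EuclideanSpace ℝ (Fin (2 ^ (a : ℕ)) × Fin (2 ^ (b : ℕ)) ×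
      Fin (2 ^ (c : ℕ)))), |g ⬝ᵥ (kron₃ U V W *ᵥ x.ofLp)| ≤ B * ‖x‖ * ‖W‖ * ‖V‖ * ‖U‖ := by
    intro U V W x
    refine IsLinearMap.abs_le_of_normingFinset (f := fun U => g ⬝ᵥ (kron₃ U V W *ᵥ x.ofLp))
      ⟨fun _ _ => by simp only [kron₃_add₁, Matrix.add_mulVec, dotProduct_add],
        fun _ _ => by simp only [kron₃_smul₁, Matrix.smul_mulVec, dotProduct_smul]⟩
      (fun U hU => ?_) U
    refine IsLinearMap.abs_le_of_normingFinset (f := fun V => g ⬝ᵥ (kron₃ U V W *ᵥ x.ofLp))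
      ⟨fun _ _ => by simp only [kron₃_add₂, Matrix.add_mulVec, dotProduct_add],
        fun _ _ => by simp only [kron₃_smul₂, Matrix.smul_mulVec, dotProduct_smul]⟩
      (fun V hV => ?_) V
    refine IsLinearMap.abs_le_of_normingFinset (f := fun W => g ⬝ᵥ (kron₃ U V W *ᵥ x.ofLp))
      ⟨fun _ _ => by simp only [kron₃_add₃, Matrix.add_mulVec, dotProduct_add],
        fun _ _ => by simp only [kron₃_smul₃, Matrix.smul_mulVec, dotProduct_smul]⟩
      (fun W hW => ?_) W
    refine IsLinearMap.abs_le_of_normingFinset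
      (f := fun x : EuclideanSpace ℝ _ => g ⬝ᵥ (kron₃ U V W *ᵥ x.ofLp))
      ⟨fun _ _ => by simp only [WithLp.ofLp_add, Matrix.mulVec_add, dotProduct_add],
        fun _ _ => by simp only [WithLp.ofLp_smul, Matrix.mulVec_smul, dotProduct_smul]⟩
      (fun x hx => ?_) x
    exact h (a, b, c) (⟨U, hU⟩, ⟨V, hV⟩, ⟨W, hW⟩, ⟨x, hx⟩)
  set y := (kron₃ U V W)ᵀ *ᵥ g with hy
  -- Testing against y itself gives ‖y‖² ≤ const · ‖y‖.
  have h1 := key U V W (WithLp.toLp 2 y)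
  have h2 : ‖WithLp.toLp 2 y‖ ^ 2 = y ⬝ᵥ y := by
    rw [EuclideanSpace.norm_sq_eq]; simp [dotProduct, ← sq]
  rw [Matrix.dotProduct_mulVec_transpose, ← hy, abs_of_nonneg (dotProduct_self_nonneg y),
    ← h2] at h1
  rw [← h2]
  refine pow_le_pow_left₀ (norm_nonneg _) ?_ 2
  rcases (norm_nonneg (WithLp.toLp 2 y)).eq_or_lt with h0 | h0
  · rw [← h0]; positivity
  · refine le_of_mul_le_mul_left ?_ h0
    rw [← sq]
    refine h1.trans (le_of_eq ?_)
    simp only [hB, D]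
    ring

/-- Sign tensors `g`, `h` for which the trilinear form `g ⬝ᵥ (X ⊗ Y ⊗ Z) h` is small on triples
of low-rank matrices of small operator norm. -/
theorem exists_sign_tensors_form_le (m : ℕ) {K : ℕ} (hK : K = 2 ^ m) :
    ∃ g h : Fin K × Fin K × Fin K → ℝ, (∀ j, g j = 1 ∨ g j = -1) ∧ (∀ j, h j = 1 ∨ h j = -1) ∧
      ∀ a b c : Fin (m + 1), ∀ (U U' : Matrix (Fin K) (Fin (2 ^ (a : ℕ))) ℝ)
        (V V' : Matrix (Fin K) (Fin (2 ^ (b : ℕ))) ℝ)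
        (W W' : Matrix (Fin K) (Fin (2 ^ (c : ℕ))) ℝ),
        |g ⬝ᵥ (kron₃ (U * U'ᵀ) (V * V'ᵀ) (W * W'ᵀ) *ᵥ h)| ≤
          9216 * √((2 * (K * (2 ^ (a : ℕ) + 2 ^ (b : ℕ) + 2 ^ (c : ℕ))) : ℕ) : ℝ) *
          √((K * (2 ^ (a : ℕ) + 2 ^ (b : ℕ) + 2 ^ (c : ℕ)) +
            2 ^ (a : ℕ) * (2 ^ (b : ℕ) * 2 ^ (c : ℕ)) : ℕ) : ℝ) *
          (‖U‖ * ‖V‖ * ‖W‖ * (‖U'‖ * ‖V'‖ * ‖W'‖)) := by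
  obtain ⟨g, hg, hgc⟩ := exists_sign_tensor_contraction_le m hK
  let T := Fin (m + 1) × Fin (m + 1) × Fin (m + 1)
  let s : T → Type := fun τ =>
    (normingFinset (Matrix (Fin K) (Fin (2 ^ (τ.1 : ℕ))) ℝ) ×
    normingFinset (Matrix (Fin K) (Fin (2 ^ (τ.2.1 : ℕ))) ℝ) ×
    normingFinset (Matrix (Fin K) (Fin (2 ^ (τ.2.2 : ℕ))) ℝ)) ×
    (normingFinset (Matrix (Fin K) (Fin (2 ^ (τ.1 : ℕ))) ℝ) ×
    normingFinset (Matrix (Fin K) (Fin (2 ^ (τ.2.1 : ℕ))) ℝ) ×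
    normingFinset (Matrix (Fin K) (Fin (2 ^ (τ.2.2 : ℕ))) ℝ))
  let D₁ : T → ℕ := fun τ => K * (2 ^ (τ.1 : ℕ) + 2 ^ (τ.2.1 : ℕ) + 2 ^ (τ.2.2 : ℕ)) +
            2 ^ (τ.1 : ℕ) * (2 ^ (τ.2.1 : ℕ) * 2 ^ (τ.2.2 : ℕ))
  -- Six matrix factors, and no test vector: h is paired directly with a vector that depends on g.
  let D : T → ℕ := fun τ => 2 * (K * (2 ^ (τ.1 : ℕ) + 2 ^ (τ.2.1 : ℕ) + 2 ^ (τ.2.2 : ℕ)))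
  obtain ⟨h, hh, H⟩ := exists_signs_forall_abs_dotProduct_le s
    (fun τ i => kron₃ i.2.1.1 i.2.2.1.1 i.2.2.2.1 *ᵥ
      ((kron₃ i.1.1.1 i.1.2.1.1 i.1.2.2.1)ᵀ *ᵥ g)) D
    -- With g fixed, this bounds the norm of the vector paired with h: each 8 is the norm of a
    -- triple of net elements, the rest is the contraction bound for g.
    (fun τ => 8 * (48 * √(D₁ τ : ℝ) * 8)) (fun τ => by
      have : 0 < D₁ τ := by simp only [D₁]; positivity
      positivity) (by
      rintro τ ⟨⟨⟨U, hU⟩, ⟨V, hV⟩, ⟨W, hW⟩⟩, ⟨U', hU'⟩, ⟨V', hV'⟩, ⟨W', hW'⟩⟩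
      have h1 : ‖kron₃ U' V' W'‖ ≤ 8 := by
        refine (l2_opNorm_kron₃_le U' V' W').trans ?_
        have := norm_le_of_mem_normingFinset hU'
        have := norm_le_of_mem_normingFinset hV'
        have := norm_le_of_mem_normingFinset hW'
        calc _ ≤ (2 : ℝ) * 2 * 2 := by gcongr
          _ = 8 := by norm_num
      refine Matrix.mulVec_dotProduct_self_le_of_norm_le h1 ?_
      refine (hgc τ.1 τ.2.1 τ.2.2 U V W).trans ?_
      have := norm_le_of_mem_normingFinset hU
      have := norm_le_of_mem_normingFinset hV
      have := norm_le_of_mem_normingFinset hW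
      have h8 : ‖U‖ * ‖V‖ * ‖W‖ ≤ 8 :=
        calc _ ≤ (2 : ℝ) * 2 * 2 := by gcongr
          _ = 8 := by norm_num
      simp only [D₁]
      gcongr) (by
      intro τ
      simp only [s, Fintype.card_prod, Fintype.card_coe]
      have h1 := card_normingFinset_le (E := Matrix (Fin K) (Fin (2 ^ (τ.1 : ℕ))) ℝ)
      have h2 := card_normingFinset_le (E := Matrix (Fin K) (Fin (2 ^ (τ.2.1 : ℕ))) ℝ)
      have h3 := card_normingFinset_le (E := Matrix (Fin K) (Fin (2 ^ (τ.2.2 : ℕ))) ℝ)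
      simp only [Module.finrank_matrix, Module.finrank_self, Fintype.card_fin, mul_one] at h1 h2 h3
      have h4 := Nat.mul_le_mul h1 (Nat.mul_le_mul h2 h3)
      calc _ ≤ _ := Nat.mul_le_mul h4 h4
        _ = _ := by
          rw [← pow_add, ← pow_add, ← pow_add]
          congr 1
          simp only [D]; ring) (by
      intro τ
      simp only [T, Fintype.card_prod, Fintype.card_fin]
      refine two_mul_pow_three_lt m K _ hK ?_
      have h1 := Nat.one_le_two_pow (n := (τ.1 : ℕ))
      have h2 := Nat.one_le_two_pow (n := (τ.2.1 : ℕ))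
      have h3 := Nat.one_le_two_pow (n := (τ.2.2 : ℕ))
      have h4 := Nat.mul_le_mul_left K (add_le_add (add_le_add h1 h2) h3)
      simp only [D]
      omega)
  refine ⟨g, h, hg, hh, fun a b c U U' V V' W W' => ?_⟩
  have hform : g ⬝ᵥ (kron₃ (U * U'ᵀ) (V * V'ᵀ) (W * W'ᵀ) *ᵥ h) =
      h ⬝ᵥ (kron₃ U' V' W' *ᵥ ((kron₃ U V W)ᵀ *ᵥ g)) := by
    rw [← kron₃_mul, ← kron₃_transpose, ← Matrix.mulVec_mulVec, Matrix.dotProduct_mulVec_transpose,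
      Matrix.dotProduct_mulVec_transpose, Matrix.transpose_transpose, dotProduct_comm]
  rw [hform]
  set B : ℝ := 3 * √(D (a, b, c)) * (8 * (48 * √(D₁ (a, b, c) : ℝ) * 8)) with hB
  have key : |h ⬝ᵥ (kron₃ U' V' W' *ᵥ ((kron₃ U V W)ᵀ *ᵥ g))| ≤
      B * ‖W'‖ * ‖V'‖ * ‖U'‖ * ‖W‖ * ‖V‖ * ‖U‖ := by
    refine IsLinearMap.abs_le_of_normingFinset
      (f := fun U => h ⬝ᵥ (kron₃ U' V' W' *ᵥ ((kron₃ U V W)ᵀ *ᵥ g)))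
      ⟨fun _ _ => by simp only [kron₃_add₁, Matrix.transpose_add, Matrix.add_mulVec,
          Matrix.mulVec_add, dotProduct_add],
        fun _ _ => by simp only [kron₃_smul₁, Matrix.transpose_smul, Matrix.smul_mulVec,
          Matrix.mulVec_smul, dotProduct_smul]⟩ (fun U hU => ?_) U
    refine IsLinearMap.abs_le_of_normingFinset
      (f := fun V => h ⬝ᵥ (kron₃ U' V' W' *ᵥ ((kron₃ U V W)ᵀ *ᵥ g)))
      ⟨fun _ _ => by simp only [kron₃_add₂, Matrix.transpose_add, Matrix.add_mulVec,
          Matrix.mulVec_add, dotProduct_add],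
        fun _ _ => by simp only [kron₃_smul₂, Matrix.transpose_smul, Matrix.smul_mulVec,
          Matrix.mulVec_smul, dotProduct_smul]⟩ (fun V hV => ?_) V
    refine IsLinearMap.abs_le_of_normingFinset
      (f := fun W => h ⬝ᵥ (kron₃ U' V' W' *ᵥ ((kron₃ U V W)ᵀ *ᵥ g)))
      ⟨fun _ _ => by simp only [kron₃_add₃, Matrix.transpose_add, Matrix.add_mulVec,
          Matrix.mulVec_add, dotProduct_add],
        fun _ _ => by simp only [kron₃_smul₃, Matrix.transpose_smul, Matrix.smul_mulVec,
          Matrix.mulVec_smul, dotProduct_smul]⟩ (fun W hW => ?_) W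
    refine IsLinearMap.abs_le_of_normingFinset
      (f := fun U' => h ⬝ᵥ (kron₃ U' V' W' *ᵥ ((kron₃ U V W)ᵀ *ᵥ g)))
      ⟨fun _ _ => by simp only [kron₃_add₁, Matrix.add_mulVec, dotProduct_add],
        fun _ _ => by simp only [kron₃_smul₁, Matrix.smul_mulVec, dotProduct_smul]⟩
      (fun U' hU' => ?_) U'
    refine IsLinearMap.abs_le_of_normingFinset
      (f := fun V' => h ⬝ᵥ (kron₃ U' V' W' *ᵥ ((kron₃ U V W)ᵀ *ᵥ g)))
      ⟨fun _ _ => by simp only [kron₃_add₂, Matrix.add_mulVec, dotProduct_add],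
        fun _ _ => by simp only [kron₃_smul₂, Matrix.smul_mulVec, dotProduct_smul]⟩
      (fun V' hV' => ?_) V'
    refine IsLinearMap.abs_le_of_normingFinset
      (f := fun W' => h ⬝ᵥ (kron₃ U' V' W' *ᵥ ((kron₃ U V W)ᵀ *ᵥ g)))
      ⟨fun _ _ => by simp only [kron₃_add₃, Matrix.add_mulVec, dotProduct_add],
        fun _ _ => by simp only [kron₃_smul₃, Matrix.smul_mulVec, dotProduct_smul]⟩
      (fun W' hW' => ?_) W'
    exact H (a, b, c) ((⟨U, hU⟩, ⟨V, hV⟩, ⟨W, hW⟩), ⟨U', hU'⟩, ⟨V', hV'⟩, ⟨W', hW'⟩)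
  refine key.trans (le_of_eq ?_)
  simp only [hB, D, D₁]
  ring

/-! ### The Frobenius norm -/

/-- The Frobenius norm. -/
noncomputable def froNorm {m n : Type*} [Fintype m] [Fintype n] (X : Matrix m n ℝ) : ℝ :=
  √(∑ i, ∑ j, X i j ^ 2)

section froNorm

variable {m n l : Type*} [Fintype m] [Fintype n] [Fintype l]

theorem froNorm_nonneg (X : Matrix m n ℝ) : 0 ≤ froNorm X := Real.sqrt_nonneg _

theorem froNorm_sq (X : Matrix m n ℝ) : froNorm X ^ 2 = ∑ i, ∑ j, X i j ^ 2 :=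
  Real.sq_sqrt (by positivity)

theorem froNorm_sq_eq_trace (X : Matrix m n ℝ) : froNorm X ^ 2 = (Xᵀ * X).trace := by
  rw [froNorm_sq, Matrix.trace, Finset.sum_comm]
  simp [Matrix.mul_apply, sq]

theorem froNorm_transpose (X : Matrix m n ℝ) : froNorm Xᵀ = froNorm X := by
  rw [froNorm, froNorm, Finset.sum_comm]; rfl

theorem abs_apply_le_froNorm (X : Matrix m n ℝ) (i : m) (j : n) : |X i j| ≤ froNorm X := by
  refine abs_le_of_sq_le_sq ?_ (froNorm_nonneg X)
  rw [froNorm_sq]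
  exact (Finset.single_le_sum (f := fun j => X i j ^ 2) (fun _ _ => sq_nonneg _)
    (Finset.mem_univ j)).trans (Finset.single_le_sum (f := fun i => ∑ j, X i j ^ 2)
    (fun _ _ => by positivity) (Finset.mem_univ i))

theorem froNorm_mul_le [DecidableEq n] (A : Matrix m n ℝ) (B : Matrix n l ℝ) :
    froNorm (A * B) ≤ ‖A‖ * froNorm B := by
  refine le_of_sq_le_sq ?_ (mul_nonneg (norm_nonneg _) (froNorm_nonneg _))
  rw [mul_pow, froNorm_sq, froNorm_sq, Finset.sum_comm, Finset.sum_comm (f := fun i j => B i j ^ 2),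
    Finset.mul_sum]
  refine Finset.sum_le_sum fun k _ => ?_
  have := A.mulVec_dotProduct_self_le (fun j => B j k)
  simpa [dotProduct, Matrix.mulVec, Matrix.mul_apply, sq] using this

theorem froNorm_mul_le' [DecidableEq n] [DecidableEq l] (A : Matrix m n ℝ) (B : Matrix n l ℝ) :
    froNorm (A * B) ≤ froNorm A * ‖B‖ := by
  rw [← froNorm_transpose, Matrix.transpose_mul, ← froNorm_transpose A, mul_comm,
    ← Matrix.l2_opNorm_transpose B]
  exact froNorm_mul_le _ _

theorem froNorm_of_transpose_mul_self_eq_one [DecidableEq n] {E : Matrix m n ℝ} (hE : Eᵀ * E = 1) :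
    froNorm E = √(Fintype.card n) := by
  rw [← Real.sqrt_sq (froNorm_nonneg E), froNorm_sq_eq_trace, hE, Matrix.trace_one]

theorem l2_opNorm_le_one_of_transpose_mul_self_eq_one [DecidableEq n] {E : Matrix m n ℝ}
    (hE : Eᵀ * E = 1) : ‖E‖ ≤ 1 := by
  refine Matrix.l2_opNorm_le_of_dotProduct zero_le_one fun x => ?_
  rw [Matrix.dotProduct_mulVec_transpose, Matrix.mulVec_mulVec, hE]
  simp

theorem froNorm_le_sqrt_card_mul [DecidableEq n] (A : Matrix m n ℝ) :
    froNorm A ≤ √(Fintype.card n) * ‖A‖ := by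
  have h := froNorm_mul_le A (1 : Matrix n n ℝ)
  rwa [Matrix.mul_one, froNorm_of_transpose_mul_self_eq_one (E := (1 : Matrix n n ℝ))
    (by rw [Matrix.transpose_one, Matrix.one_mul]), mul_comm] at h

theorem froNorm_mul_transpose_le {k : ℕ} [DecidableEq m] {U V : Matrix m (Fin k) ℝ} {s : ℝ}
    (hU : ‖U‖ ≤ s) (hV : ‖V‖ ≤ 1) : froNorm (U * Vᵀ) ≤ √k * s := by
  have h1 := froNorm_mul_le' U Vᵀ
  rw [Matrix.l2_opNorm_transpose] at h1
  have h2 := froNorm_le_sqrt_card_mul U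
  rw [Fintype.card_fin] at h2
  calc _ ≤ froNorm U * ‖V‖ := h1
    _ ≤ froNorm U * 1 := by gcongr; exact froNorm_nonneg U
    _ ≤ √k * ‖U‖ := by simpa using h2
    _ ≤ _ := by gcongr

end froNorm

/-! ### Singular vectors and dyadic blocks -/

/-- Orthonormal coordinates for the column space. -/
theorem exists_isometry_onto_columns {m n : Type*} [Fintype m] [Fintype n]
    (G : Matrix m n ℝ) : ∃ d ≤ Fintype.card n, ∃ E : Matrix m (Fin d) ℝ,
      Eᵀ * E = 1 ∧ E * (Eᵀ * G) = G := by
  let col : n → EuclideanSpace ℝ m := fun k => WithLp.toLp 2 fun i => G i k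
  let S : Submodule ℝ (EuclideanSpace ℝ m) := Submodule.span ℝ (Set.range col)
  obtain ⟨b⟩ : Nonempty (OrthonormalBasis (Fin (Module.finrank ℝ S)) ℝ S) :=
    ⟨stdOrthonormalBasis ℝ S⟩
  refine ⟨Module.finrank ℝ S, finrank_range_le_card col,
    Matrix.of fun i k => (b k : EuclideanSpace ℝ m) i, ?_, ?_⟩
  · ext j k
    have h := orthonormal_iff_ite.1 b.orthonormal j k
    rw [Submodule.coe_inner, PiLp.inner_apply] at h
    rw [Matrix.one_apply, ← h, Matrix.mul_apply]
    exact Finset.sum_congr rfl fun i _ => mul_comm _ _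
  · ext i k
    have hk : col k ∈ S := Submodule.subset_span ⟨k, rfl⟩
    have h := congrArg (fun x : S => (x : EuclideanSpace ℝ m) i) (b.sum_repr' ⟨col k, hk⟩)
    simp only [Submodule.coe_sum, Submodule.coe_smul, Submodule.coe_inner, PiLp.inner_apply] at h
    rw [Matrix.mul_apply]
    refine Eq.trans ?_ h
    rw [WithLp.ofLp_sum, Finset.sum_apply]
    refine Finset.sum_congr rfl fun a _ => ?_
    rw [Matrix.mul_apply, mul_comm]
    congr 1
    exact Finset.sum_congr rfl fun i _ => mul_comm _ _

/-- An orthogonal matrix whose columns are right singular vectors, in order. -/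
theorem exists_singular_vectors {K : ℕ} (X : Matrix (Fin K) (Fin K) ℝ) :
    ∃ (Q : Matrix (Fin K) (Fin K) ℝ) (μ : Fin K → ℝ), Antitone μ ∧ Qᵀ * Q = 1 ∧
      (X * Q)ᵀ * (X * Q) = Matrix.diagonal μ := by
  have hA : (Xᵀ * X).IsHermitian := by
    have := Matrix.isHermitian_conjTranspose_mul_self X
    rwa [Matrix.conjTranspose_eq_transpose_of_trivial] at this
  have hT := Matrix.isSymmetric_toEuclideanLin_iff.2 hA
  have hn : Module.finrank ℝ (EuclideanSpace ℝ (Fin K)) = K := by simp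
  let b := hT.eigenvectorBasis hn
  let Q : Matrix (Fin K) (Fin K) ℝ := Matrix.of fun i k => b k i
  have hQ : Qᵀ * Q = 1 := by
    ext j k
    have h := orthonormal_iff_ite.1 b.orthonormal j k
    rw [PiLp.inner_apply] at h
    rw [Matrix.one_apply, ← h, Matrix.mul_apply]
    simp [Q, mul_comm]
  refine ⟨Q, hT.eigenvalues hn, hT.eigenvalues_antitone hn, hQ, ?_⟩
  have h1 : (Xᵀ * X) * Q = Q * Matrix.diagonal (hT.eigenvalues hn) := by
    ext i k
    have h := congrArg (fun x : EuclideanSpace ℝ (Fin K) => x i) (hT.apply_eigenvectorBasis hn k)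
    simp only [Matrix.toLpLin_apply] at h
    rw [Matrix.mul_diagonal, mul_comm]
    exact h
  rw [Matrix.transpose_mul, Matrix.mul_assoc, ← Matrix.mul_assoc Xᵀ, h1, ← Matrix.mul_assoc, hQ,
    Matrix.one_mul]

/-- Cauchy condensation: half of each term beyond the first is dominated by the preceding dyadic
block of the decreasing sequence. -/
theorem sum_two_pow_mul_le {μ : ℕ → ℝ} (hμ : Antitone μ) (hμ0 : ∀ k, 0 ≤ μ k) (m : ℕ) :
    ∑ l ∈ Finset.range (m + 1), 2 ^ l * μ (2 ^ l - 1) ≤ 2 * ∑ k ∈ Finset.range (2 ^ m), μ k := by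
  induction m with
  | zero => have := hμ0 0; simp; linarith
  | succ m ih =>
    rw [Finset.sum_range_succ]
    have h1 : ∑ k ∈ Finset.range (2 ^ (m + 1)), μ k =
        ∑ k ∈ Finset.range (2 ^ m), μ k + ∑ k ∈ Finset.range (2 ^ m), μ (2 ^ m + k) := by
      rw [pow_succ, mul_two, Finset.sum_range_add]
    have h2 : (2 : ℝ) ^ m * μ (2 ^ (m + 1) - 1) ≤ ∑ k ∈ Finset.range (2 ^ m), μ (2 ^ m + k) := by
      have := Finset.card_nsmul_le_sum (Finset.range (2 ^ m)) (fun k => μ (2 ^ m + k))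
        (μ (2 ^ (m + 1) - 1)) (fun k hk => hμ (by
          have := Finset.mem_range.1 hk
          rw [pow_succ]; omega))
      simpa using this
    rw [h1, pow_succ (2 : ℝ)]
    linarith

/-- Every matrix is a sum of few matrices `U * Vᵀ` of dyadic ranks. -/
theorem exists_dyadic_decomposition (m : ℕ) {K : ℕ} (hK : K = 2 ^ m)
    (X : Matrix (Fin K) (Fin K) ℝ) :
    ∃ (U V : ∀ l : Fin (m + 1), Matrix (Fin K) (Fin (2 ^ (l : ℕ))) ℝ) (s : Fin (m + 1) → ℝ),
      X = ∑ l, U l * (V l)ᵀ ∧ (∀ l, ‖U l‖ ≤ s l) ∧ (∀ l, ‖V l‖ ≤ 1) ∧ (∀ l, 0 ≤ s l) ∧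
      ∑ l : Fin (m + 1), 2 ^ (l : ℕ) * s l ^ 2 ≤ 2 * froNorm X ^ 2 := by
  obtain ⟨Q, μ, hμ, hQ, hXQ⟩ := exists_singular_vectors X
  have hQ' : Q * Qᵀ = 1 := mul_eq_one_comm.1 hQ
  have hμ0 : ∀ k, 0 ≤ μ k := by
    intro k
    have h := congrFun (congrFun hXQ k) k
    rw [Matrix.diagonal_apply_eq, Matrix.mul_apply] at h
    rw [← h]
    exact Finset.sum_nonneg fun i _ => mul_self_nonneg _
  let ν : ℕ → ℝ := fun k => if h : k < K then μ ⟨k, h⟩ else 0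
  have hν0 : ∀ k, 0 ≤ ν k := by
    intro k
    simp only [ν]
    split_ifs
    exacts [hμ0 _, le_rfl]
  have hν : Antitone ν := by
    intro j k hjk
    by_cases hk : k < K
    · have hj : j < K := by omega
      simp only [ν, hk, hj, dite_true]
      exact hμ hjk
    · have : ν k = 0 := by simp [ν, hk]
      rw [this]
      exact hν0 j
  have hsumν : ∑ k ∈ Finset.range K, ν k = froNorm X ^ 2 := by
    rw [← Fin.sum_univ_eq_sum_range]
    have h1 : froNorm X ^ 2 = ((X * Q)ᵀ * (X * Q)).trace := by
      rw [froNorm_sq_eq_trace, Matrix.transpose_mul, Matrix.mul_assoc, Matrix.trace_mul_comm Qᵀ,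
        Matrix.mul_assoc, Matrix.mul_assoc, hQ', Matrix.mul_one]
    rw [h1, hXQ, Matrix.trace_diagonal]
    exact Finset.sum_congr rfl fun i _ => by simp [ν]
  -- `P l` selects the singular directions k with 2^l ≤ k + 1 < 2^(l+1). As k + 1 ≤ 2^m, the last
  -- block holds a single direction and its other columns are zero, so `P l` is only a contraction
  -- in general.
  let P : ∀ l : Fin (m + 1), Matrix (Fin K) (Fin (2 ^ (l : ℕ))) ℝ :=
    fun l => Matrix.of fun k a => if (k : ℕ) + 1 = 2 ^ (l : ℕ) + a then 1 else 0
  have hPP : ∀ l, P l * (P l)ᵀ = Matrix.diagonal fun k : Fin K =>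
      if Nat.log 2 ((k : ℕ) + 1) = l then (1 : ℝ) else 0 := by
    intro l
    ext j k
    rw [Matrix.mul_apply, Matrix.diagonal_apply]
    simp only [Matrix.transpose_apply, P, Matrix.of_apply, mul_ite, mul_one, mul_zero]
    have hlog : Nat.log 2 ((j : ℕ) + 1) = l ↔ 2 ^ (l : ℕ) ≤ (j : ℕ) + 1 ∧
        (j : ℕ) + 1 < 2 ^ ((l : ℕ) + 1) := Nat.log_eq_iff (Or.inr ⟨by norm_num, by omega⟩)
    by_cases hjk : j = k
    · subst hjk
      rw [if_pos rfl]
      by_cases hl : Nat.log 2 ((j : ℕ) + 1) = l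
      · obtain ⟨h1, h2⟩ := hlog.1 hl
        rw [pow_succ] at h2
        rw [if_pos hl, Finset.sum_eq_single ⟨(j : ℕ) + 1 - 2 ^ (l : ℕ), by omega⟩]
        · simp only; rw [if_pos (by omega), if_pos (by omega)]
        · intro a _ ha
          split_ifs with h3
          · exact absurd (Fin.ext (by simp only; omega)) ha
          · rfl
        · simp
      · rw [if_neg hl]
        refine Finset.sum_eq_zero fun a _ => ?_
        split_ifs with h3
        · exact absurd (hlog.2 ⟨by omega, by rw [pow_succ]; omega⟩) hl
        · rfl
    · rw [if_neg hjk]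
      refine Finset.sum_eq_zero fun a _ => ?_
      split_ifs with h3 h4
      · exact absurd (Fin.ext (by omega)) hjk
      · rfl
      · rfl
  have hPsum : ∑ l, P l * (P l)ᵀ = 1 := by
    simp_rw [hPP]
    rw [← Matrix.diagonal_one]
    ext j k
    rw [Matrix.sum_apply]
    by_cases hjk : j = k
    · subst hjk
      simp only [Matrix.diagonal_apply_eq]
      have hj : Nat.log 2 ((j : ℕ) + 1) < m + 1 := by
        refine Nat.log_lt_of_lt_pow (by omega) ?_
        have := j.2
        rw [pow_succ]; omega
      rw [Finset.sum_eq_single ⟨_, hj⟩]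
      · simp
      · intro l _ hl
        exact if_neg fun h => hl (Fin.ext h.symm)
      · simp
    · simp [Matrix.diagonal_apply_ne _ hjk]
  have hPP' : ∀ (l : Fin (m + 1)) (x : Fin (2 ^ (l : ℕ)) → ℝ), (P l *ᵥ x) ⬝ᵥ (P l *ᵥ x) ≤ x ⬝ᵥ x := by
    intro l x
    rw [Matrix.dotProduct_mulVec_transpose, Matrix.mulVec_mulVec]
    refine Finset.sum_le_sum fun a _ => ?_
    have h1 : (((P l)ᵀ * P l) *ᵥ x) a = ((P l)ᵀ * P l) a a * x a := by
      rw [Matrix.mulVec, dotProduct]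
      refine Finset.sum_eq_single a (fun b _ hb => ?_) (by simp)
      rw [Matrix.mul_apply]
      convert zero_mul (x b)
      refine Finset.sum_eq_zero fun k _ => ?_
      simp only [Matrix.transpose_apply, P, Matrix.of_apply, mul_ite, mul_one, mul_zero]
      split_ifs with h1 h2
      · exact absurd (Fin.ext (by omega)) hb
      · rfl
      · rfl
    have h2 : ((P l)ᵀ * P l) a a ≤ 1 := by
      rw [Matrix.mul_apply]
      simp only [Matrix.transpose_apply, P, Matrix.of_apply, mul_ite, mul_one, mul_zero]
      by_cases h : 2 ^ (l : ℕ) + (a : ℕ) - 1 < K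
      · rw [Finset.sum_eq_single ⟨_, h⟩]
        · split_ifs <;> norm_num
        · intro k _ hk
          split_ifs with h3
          · exact absurd (Fin.ext (by simp only; omega)) hk
          · rfl
        · simp
      · rw [Finset.sum_eq_zero]
        · norm_num
        · intro k _
          have := k.2
          rw [if_neg (by omega)]
    rw [h1]
    nlinarith [mul_self_nonneg (x a)]
  have hPnorm : ∀ l, ‖P l‖ ≤ 1 := fun l =>
    Matrix.l2_opNorm_le_of_dotProduct zero_le_one fun x => by simpa using hPP' l x
  refine ⟨fun l => X * Q * P l, fun l => Q * P l, fun l => √(ν (2 ^ (l : ℕ) - 1)), ?_, ?_, ?_,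
    fun l => Real.sqrt_nonneg _, ?_⟩
  · have h1 : ∀ l, X * Q * P l * (Q * P l)ᵀ = X * Q * (P l * (P l)ᵀ) * Qᵀ := by
      intro l
      simp only [Matrix.transpose_mul, Matrix.mul_assoc]
    simp_rw [h1]
    rw [← Matrix.sum_mul, ← Matrix.mul_sum, hPsum, Matrix.mul_one, Matrix.mul_assoc, hQ',
      Matrix.mul_one]
  · intro l
    refine Matrix.l2_opNorm_le_of_dotProduct (Real.sqrt_nonneg _) fun x => ?_
    -- The columns of X Q are orthogonal with decreasing squared lengths, so the first index of a
    -- block bounds the whole block.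
    rw [Real.sq_sqrt (hν0 _), ← Matrix.mulVec_mulVec, Matrix.dotProduct_mulVec_transpose,
      Matrix.mulVec_mulVec, hXQ]
    refine le_trans ?_ (mul_le_mul_of_nonneg_left (hPP' l x) (hν0 _))
    rw [dotProduct, dotProduct, Finset.mul_sum]
    refine Finset.sum_le_sum fun k _ => ?_
    rw [Matrix.mulVec_diagonal, mul_assoc]
    by_cases hk : 2 ^ (l : ℕ) - 1 ≤ (k : ℕ)
    · refine mul_le_mul_of_nonneg_right ?_ (mul_self_nonneg _)
      have : μ k = ν k := by simp [ν]
      rw [this]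
      exact hν hk
    · have : (P l *ᵥ x) k = 0 := by
        rw [Matrix.mulVec, dotProduct]
        refine Finset.sum_eq_zero fun a _ => ?_
        simp only [P, Matrix.of_apply]
        rw [if_neg (by omega), zero_mul]
      rw [this]; simp
  · intro l
    calc _ ≤ ‖Q‖ * ‖P l‖ := Matrix.l2_opNorm_mul _ _
      _ ≤ 1 * 1 := by
        gcongr
        exacts [l2_opNorm_le_one_of_transpose_mul_self_eq_one hQ, hPnorm l]
      _ = 1 := by norm_num
  · have := sum_two_pow_mul_le hν hν0 m
    rw [← hK, hsumν, ← Fin.sum_univ_eq_sum_range (fun l => (2 : ℝ) ^ l * ν (2 ^ l - 1))] at this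
    refine le_trans (le_of_eq ?_) this
    exact Finset.sum_congr rfl fun l _ => by rw [Real.sq_sqrt (hν0 _)]

/-! ### The trilinear form and rank reduction -/

/-- The trilinear form `∑ g i j k * h i' j' k' * X i i' * Y j j' * Z k k'`. -/
def triForm {l₁ l₂ l₃ m₁ m₂ m₃ : Type*} [Fintype l₁] [Fintype l₂] [Fintype l₃] [Fintype m₁]
    [Fintype m₂] [Fintype m₃] (g : l₁ × l₂ × l₃ → ℝ) (h : m₁ × m₂ × m₃ → ℝ)
    (X : Matrix l₁ m₁ ℝ) (Y : Matrix l₂ m₂ ℝ) (Z : Matrix l₃ m₃ ℝ) : ℝ :=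
  g ⬝ᵥ (kron₃ X Y Z *ᵥ h)

section triForm

variable {l₁ l₂ l₃ m₁ m₂ m₃ : Type*} [Fintype l₁] [Fintype l₂] [Fintype l₃] [Fintype m₁]
    [Fintype m₂] [Fintype m₃] (g : l₁ × l₂ × l₃ → ℝ) (h : m₁ × m₂ × m₃ → ℝ)
    (X X' : Matrix l₁ m₁ ℝ) (Y Y' : Matrix l₂ m₂ ℝ) (Z Z' : Matrix l₃ m₃ ℝ)

theorem triForm_add₁ : triForm g h (X + X') Y Z = triForm g h X Y Z + triForm g h X' Y Z := by
  simp only [triForm, kron₃_add₁, Matrix.add_mulVec, dotProduct_add]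

theorem triForm_add₂ : triForm g h X (Y + Y') Z = triForm g h X Y Z + triForm g h X Y' Z := by
  simp only [triForm, kron₃_add₂, Matrix.add_mulVec, dotProduct_add]

theorem triForm_add₃ : triForm g h X Y (Z + Z') = triForm g h X Y Z + triForm g h X Y Z' := by
  simp only [triForm, kron₃_add₃, Matrix.add_mulVec, dotProduct_add]

theorem triForm_sum₁ {ι : Type*} [Fintype ι] (X : ι → Matrix l₁ m₁ ℝ) :
    triForm g h (∑ i, X i) Y Z = ∑ i, triForm g h (X i) Y Z :=
  map_sum (AddMonoidHom.mk' (fun X => triForm g h X Y Z) fun X X' => triForm_add₁ g h X X' Y Z) _ _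

theorem triForm_sum₂ {ι : Type*} [Fintype ι] (Y : ι → Matrix l₂ m₂ ℝ) :
    triForm g h X (∑ i, Y i) Z = ∑ i, triForm g h X (Y i) Z :=
  map_sum (AddMonoidHom.mk' (fun Y => triForm g h X Y Z) fun Y Y' => triForm_add₂ g h X Y Y' Z) _ _

theorem triForm_sum₃ {ι : Type*} [Fintype ι] (Z : ι → Matrix l₃ m₃ ℝ) :
    triForm g h X Y (∑ i, Z i) = ∑ i, triForm g h X Y (Z i) :=
  map_sum (AddMonoidHom.mk' (fun Z => triForm g h X Y Z) fun Z Z' => triForm_add₃ g h X Y Z Z') _ _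

theorem triForm_eq_sum : triForm g h X Y Z =
    ∑ x, ∑ y, g x * h y * (X x.1 y.1 * Y x.2.1 y.2.1 * Z x.2.2 y.2.2) := by
  simp only [triForm, dotProduct, Matrix.mulVec, Finset.mul_sum]
  refine Finset.sum_congr rfl fun x _ => Finset.sum_congr rfl fun y _ => ?_
  simp only [kron₃, Matrix.kroneckerMap_apply]
  ring

/-- Exchange of the first two factors. -/
def prodSwap₁₂ (α β γ : Type*) : α × β × γ ≃ β × α × γ where
  toFun x := (x.2.1, x.1, x.2.2)
  invFun x := (x.2.1, x.1, x.2.2)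

/-- Exchange of the first and the third factor. -/
def prodSwap₁₃ (α β γ : Type*) : α × β × γ ≃ γ × β × α where
  toFun x := (x.2.2, x.2.1, x.1)
  invFun x := (x.2.2, x.2.1, x.1)

theorem triForm_swap₁₂ : triForm g h X Y Z =
    triForm (g ∘ prodSwap₁₂ _ _ _) (h ∘ prodSwap₁₂ _ _ _) Y X Z := by
  rw [triForm_eq_sum, triForm_eq_sum]
  refine Fintype.sum_equiv (prodSwap₁₂ _ _ _) _ _ fun x =>
    Fintype.sum_equiv (prodSwap₁₂ _ _ _) _ _ fun y => ?_
  simp only [prodSwap₁₂, Function.comp, Equiv.coe_fn_mk]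
  ring

theorem triForm_swap₁₃ : triForm g h X Y Z =
    triForm (g ∘ prodSwap₁₃ _ _ _) (h ∘ prodSwap₁₃ _ _ _) Z Y X := by
  rw [triForm_eq_sum, triForm_eq_sum]
  refine Fintype.sum_equiv (prodSwap₁₃ _ _ _) _ _ fun x =>
    Fintype.sum_equiv (prodSwap₁₃ _ _ _) _ _ fun y => ?_
  simp only [prodSwap₁₃, Function.comp, Equiv.coe_fn_mk]
  ring

theorem abs_triForm_le : |triForm g h X Y Z| ≤
    (∑ x, ∑ y, |g x * h y|) * (froNorm X * froNorm Y * froNorm Z) := by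
  rw [triForm_eq_sum, Finset.sum_mul]
  refine (Finset.abs_sum_le_sum_abs _ _).trans (Finset.sum_le_sum fun x _ => ?_)
  rw [Finset.sum_mul]
  refine (Finset.abs_sum_le_sum_abs _ _).trans (Finset.sum_le_sum fun y _ => ?_)
  rw [abs_mul (g x * h y), abs_mul (X _ _ * Y _ _), abs_mul (X _ _)]
  have := froNorm_nonneg X
  have := froNorm_nonneg Y
  gcongr
  exacts [abs_apply_le_froNorm X _ _, abs_apply_le_froNorm Y _ _, abs_apply_le_froNorm Z _ _]

/-- If the second and third arguments have low rank, the Frobenius norm of the first one can be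
replaced by a multiple of its operator norm. -/
theorem abs_triForm_mul_transpose_le [DecidableEq l₁] [DecidableEq m₁] {q₂ q₃ : ℕ} {β : ℝ}
    (hβ0 : 0 ≤ β)
    (hβ : ∀ X Y Z, |triForm g h X Y Z| ≤ β * (froNorm X * froNorm Y * froNorm Z))
    (V : Matrix l₂ (Fin q₂) ℝ) (V' : Matrix m₂ (Fin q₂) ℝ) (W : Matrix l₃ (Fin q₃) ℝ)
    (W' : Matrix m₃ (Fin q₃) ℝ) :
    |triForm g h X (V * V'ᵀ) (W * W'ᵀ)| ≤
      β * (√((q₂ * q₃ : ℕ) : ℝ) * ‖X‖ * froNorm (V * V'ᵀ) * froNorm (W * W'ᵀ)) := by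
  -- G is g contracted with V and W. It has q₂q₃ columns, and the form sees X only through Xᵀ G, so
  -- X may be projected onto the column space of G.
  let G : Matrix l₁ (Fin q₂ × Fin q₃) ℝ :=
    Matrix.of fun i b => ((kron₃ (1 : Matrix l₁ l₁ ℝ) V W)ᵀ *ᵥ g) (i, b)
  obtain ⟨d, hd, E, hE, hEG⟩ := exists_isometry_onto_columns G
  have hproj : ∀ P : Matrix l₁ l₁ ℝ, (kron₃ P V W)ᵀ *ᵥ g = fun x => (Pᵀ * G) x.1 x.2 := by
    intro P
    have h1 : kron₃ P V W =
        kron₃ (1 : Matrix l₁ l₁ ℝ) V W * kron₃ P (1 : Matrix (Fin q₂) (Fin q₂) ℝ)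
          (1 : Matrix (Fin q₃) (Fin q₃) ℝ) := by
      rw [kron₃_mul, Matrix.one_mul, Matrix.mul_one, Matrix.mul_one]
    rw [h1, Matrix.transpose_mul, ← Matrix.mulVec_mulVec, kron₃_transpose P]
    ext ⟨i, b, c⟩
    simp only [Matrix.mulVec, dotProduct, Matrix.mul_apply, G, Matrix.of_apply,
      Fintype.sum_prod_type, kron₃, Matrix.kroneckerMap_apply, Matrix.transpose_one,
      Matrix.one_apply]
    simp
  have hX : triForm g h (E * Eᵀ * X) (V * V'ᵀ) (W * W'ᵀ) =
      triForm g h X (V * V'ᵀ) (W * W'ᵀ) := by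
    have h1 : ∀ P : Matrix l₁ l₁ ℝ, triForm g h (P * X) (V * V'ᵀ) (W * W'ᵀ) =
        ((kron₃ P V W)ᵀ *ᵥ g) ⬝ᵥ (kron₃ X V'ᵀ W'ᵀ *ᵥ h) := by
      intro P
      rw [triForm, ← kron₃_mul, ← Matrix.mulVec_mulVec, Matrix.dotProduct_mulVec_transpose]
    rw [h1, hproj, Matrix.transpose_mul, Matrix.transpose_transpose, Matrix.mul_assoc, hEG]
    have h2 := h1 1
    rw [Matrix.one_mul, hproj, Matrix.transpose_one, Matrix.one_mul] at h2
    exact h2.symm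
  -- A projection of rank at most q₂q₃ has Frobenius norm at most √(q₂q₃).
  have hfro : froNorm (E * Eᵀ * X) ≤ √((q₂ * q₃ : ℕ) : ℝ) * ‖X‖ := by
    rw [Matrix.mul_assoc]
    calc _ ≤ ‖E‖ * froNorm (Eᵀ * X) := froNorm_mul_le _ _
      _ ≤ 1 * (froNorm Eᵀ * ‖X‖) := by
        gcongr
        exacts [froNorm_nonneg _, l2_opNorm_le_one_of_transpose_mul_self_eq_one hE,
          froNorm_mul_le' _ _]
      _ ≤ _ := by
        rw [one_mul, froNorm_transpose, froNorm_of_transpose_mul_self_eq_one hE, Fintype.card_fin]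
        gcongr
        simpa using hd
  rw [← hX]
  refine (hβ _ _ _).trans ?_
  have := froNorm_nonneg (V * V'ᵀ)
  have := froNorm_nonneg (W * W'ᵀ)
  gcongr

end triForm

/-! ### Summation over dyadic scales -/

theorem sum_inv_two_pow_le (n : ℕ) {M : ℝ} (hM : 0 < M) :
    ∑ i ∈ Finset.range n, (if M < 2 ^ i then ((2 : ℝ) ^ i)⁻¹ else 0) ≤ 2 / M := by
  induction n generalizing M with
  | zero => simp; positivity
  | succ n ih =>
    rcases lt_or_ge M 1 with h | h
    · calc _ ≤ ∑ i ∈ Finset.range (n + 1), ((1 : ℝ) / 2) ^ i := by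
            refine Finset.sum_le_sum fun i _ => ?_
            rw [one_div, inv_pow]
            split_ifs
            · exact le_rfl
            · positivity
        _ ≤ 2 := sum_geometric_two_le _
        _ ≤ 2 / M := by rw [le_div_iff₀ hM]; linarith
    · rw [Finset.sum_range_succ', pow_zero, if_neg (by linarith), add_zero]
      have h1 := ih (half_pos hM)
      have h2 : ∀ i : ℕ, (if M < 2 ^ (i + 1) then ((2 : ℝ) ^ (i + 1))⁻¹ else 0) =
          1 / 2 * (if M / 2 < 2 ^ i then ((2 : ℝ) ^ i)⁻¹ else 0) := by
        intro i
        rw [pow_succ]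
        by_cases h3 : M / 2 < 2 ^ i
        · rw [if_pos h3, if_pos (by linarith), mul_inv]; ring
        · rw [if_neg h3, if_neg (by linarith), mul_zero]
      simp_rw [h2]
      rw [← Finset.mul_sum]
      calc _ ≤ 1 / 2 * (2 / (M / 2)) := by gcongr
        _ = 2 / M := by field_simp

/-- Cauchy–Schwarz with weights 2^(i/2) against a geometric tail: only scales above M count, so no
factor L appears. -/
theorem sum_large_le {L : ℕ} {s : Fin L → ℝ} {A M : ℝ} (hA : 0 ≤ A)
    (hs : ∑ i : Fin L, 2 ^ (i : ℕ) * s i ^ 2 ≤ 2 * A ^ 2) (hM : 0 < M) :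
    ∑ i : Fin L, (if M < 2 ^ (i : ℕ) then s i else 0) ≤ 2 * A / √M := by
  have h1 : ∑ i : Fin L, (if M < 2 ^ (i : ℕ) then s i else 0) =
      ∑ i : Fin L, (√(2 ^ (i : ℕ)) * s i) * (if M < 2 ^ (i : ℕ) then (√(2 ^ (i : ℕ)))⁻¹ else 0) := by
    refine Finset.sum_congr rfl fun i _ => ?_
    split_ifs
    · have : √((2 : ℝ) ^ (i : ℕ)) ≠ 0 := by positivity
      field_simp
    · simp
  rw [h1]
  refine le_of_sq_le_sq ?_ (by positivity)
  refine (Finset.sum_mul_sq_le_sq_mul_sq _ _ _).trans ?_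
  rw [div_pow, Real.sq_sqrt hM.le]
  have h2 : ∑ i : Fin L, (√(2 ^ (i : ℕ)) * s i) ^ 2 ≤ 2 * A ^ 2 := by
    refine le_trans (le_of_eq (Finset.sum_congr rfl fun i _ => ?_)) hs
    rw [mul_pow, Real.sq_sqrt (by positivity)]
  have h3 : ∑ i : Fin L, (if M < 2 ^ (i : ℕ) then (√((2 : ℝ) ^ (i : ℕ)))⁻¹ else 0) ^ 2 ≤ 2 / M := by
    refine le_trans (le_of_eq ?_) (sum_inv_two_pow_le L hM)
    rw [← Fin.sum_univ_eq_sum_range (fun i => if M < 2 ^ i then ((2 : ℝ) ^ i)⁻¹ else 0)]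
    refine Finset.sum_congr rfl fun i _ => ?_
    split_ifs
    · rw [inv_pow, Real.sq_sqrt (by positivity)]
    · simp
  calc _ ≤ 2 * A ^ 2 * (2 / M) := by gcongr
    _ = _ := by ring

/-- Plain Cauchy–Schwarz over L scales; each use costs √L in the final bound. -/
theorem sum_sqrt_mul_le {L : ℕ} {s : Fin L → ℝ} {A : ℝ} (hA : 0 ≤ A)
    (hs : ∑ i : Fin L, 2 ^ (i : ℕ) * s i ^ 2 ≤ 2 * A ^ 2) :
    ∑ i : Fin L, √(2 ^ (i : ℕ)) * s i ≤ √(2 * L) * A := by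
  refine le_of_sq_le_sq ?_ (by positivity)
  have h := Finset.sum_mul_sq_le_sq_mul_sq Finset.univ
    (fun i : Fin L => √(2 ^ (i : ℕ)) * s i) (fun _ => 1)
  simp only [mul_one, one_pow, Finset.sum_const, Finset.card_univ, Fintype.card_fin,
    nsmul_eq_mul] at h
  refine h.trans ?_
  rw [mul_pow, Real.sq_sqrt (by positivity)]
  have h2 : ∑ i : Fin L, (√(2 ^ (i : ℕ)) * s i) ^ 2 ≤ 2 * A ^ 2 := by
    refine le_trans (le_of_eq (Finset.sum_congr rfl fun i _ => ?_)) hs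
    rw [mul_pow, Real.sq_sqrt (by positivity)]
  nlinarith [(Nat.cast_nonneg L : (0 : ℝ) ≤ L)]

/-- The tail over i gives 2A/√(ρ 2^j 2^k), which exactly cancels the rank factor √(2^j 2^k). The
sums over j and k then cost √(2L) each. -/
theorem sum_unbalanced_le {L : ℕ} {ρ A B C : ℝ} (hρ : 0 < ρ) {s t u : Fin L → ℝ}
    (ht0 : ∀ i, 0 ≤ t i) (hu0 : ∀ i, 0 ≤ u i) (hA : 0 ≤ A) (hB : 0 ≤ B) (hC : 0 ≤ C)
    (hs : ∑ i : Fin L, 2 ^ (i : ℕ) * s i ^ 2 ≤ 2 * A ^ 2)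
    (ht : ∑ i : Fin L, 2 ^ (i : ℕ) * t i ^ 2 ≤ 2 * B ^ 2)
    (hu : ∑ i : Fin L, 2 ^ (i : ℕ) * u i ^ 2 ≤ 2 * C ^ 2) :
    ∑ j : Fin L, ∑ k : Fin L, ∑ i : Fin L,
      (if ρ * (2 ^ (j : ℕ) * 2 ^ (k : ℕ)) < 2 ^ (i : ℕ) then
        √(2 ^ (j : ℕ) * 2 ^ (k : ℕ)) * s i * (√(2 ^ (j : ℕ)) * t j) * (√(2 ^ (k : ℕ)) * u k)
        else 0) ≤ 4 * L / √ρ * (A * B * C) := by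
  have h1 : ∀ j k : Fin L, ∑ i : Fin L,
      (if ρ * (2 ^ (j : ℕ) * 2 ^ (k : ℕ)) < 2 ^ (i : ℕ) then
        √(2 ^ (j : ℕ) * 2 ^ (k : ℕ)) * s i * (√(2 ^ (j : ℕ)) * t j) * (√(2 ^ (k : ℕ)) * u k)
        else 0) ≤ (2 * A / √ρ) * ((√(2 ^ (j : ℕ)) * t j) * (√(2 ^ (k : ℕ)) * u k)) := by
    intro j k
    have h2 := sum_large_le hA hs (M := ρ * (2 ^ (j : ℕ) * 2 ^ (k : ℕ))) (by positivity)
    have h3 : 0 ≤ (√(2 ^ (j : ℕ)) * t j) * (√(2 ^ (k : ℕ)) * u k) := by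
      have := ht0 j
      have := hu0 k
      positivity
    rw [Real.sqrt_mul hρ.le] at h2
    have h4 : (0 : ℝ) < √(2 ^ (j : ℕ) * 2 ^ (k : ℕ)) := by positivity
    have h5 := mul_le_mul_of_nonneg_right h2
      (mul_nonneg h4.le h3)
    refine le_trans (le_of_eq ?_) (h5.trans (le_of_eq ?_))
    · rw [Finset.sum_mul]
      refine Finset.sum_congr rfl fun i _ => ?_
      split_ifs <;> ring
    · field_simp
  have hb := sum_sqrt_mul_le hB ht
  have hc := sum_sqrt_mul_le hC hu
  calc _ ≤ ∑ j : Fin L, ∑ k : Fin L,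
        (2 * A / √ρ) * ((√(2 ^ (j : ℕ)) * t j) * (√(2 ^ (k : ℕ)) * u k)) :=
        Finset.sum_le_sum fun j _ => Finset.sum_le_sum fun k _ => h1 j k
    _ = (2 * A / √ρ) * ((∑ j : Fin L, √(2 ^ (j : ℕ)) * t j) *
          ∑ k : Fin L, √(2 ^ (k : ℕ)) * u k) := by
        simp_rw [← Finset.mul_sum]
        rw [← Finset.sum_mul]
    _ ≤ (2 * A / √ρ) * ((√(2 * L) * B) * (√(2 * L) * C)) := by
        gcongr
        exact Finset.sum_nonneg fun k _ => mul_nonneg (Real.sqrt_nonneg _) (hu0 k)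
    _ = (2 * A / √ρ) * ((√(2 * L) * √(2 * L)) * (B * C)) := by ring
    _ = _ := by rw [Real.mul_self_sqrt (by positivity)]; ring

/-- Every triple is either balanced (`h0`) or has one dominant scale (`h1`, `h2`, `h3`). The
balanced part costs √(2L) per argument; the three unbalanced parts cost 4L/√ρ each, hence the 12. -/
theorem sum_triple_le {L : ℕ} {ρ A B C M β : ℝ} (hρ : 0 < ρ) (hM : 0 ≤ M) (hβ : 0 ≤ β)
    {s t u : Fin L → ℝ}
    (hs0 : ∀ i, 0 ≤ s i) (ht0 : ∀ i, 0 ≤ t i) (hu0 : ∀ i, 0 ≤ u i)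
    (hA : 0 ≤ A) (hB : 0 ≤ B) (hC : 0 ≤ C)
    (hs : ∑ i : Fin L, 2 ^ (i : ℕ) * s i ^ 2 ≤ 2 * A ^ 2)
    (ht : ∑ i : Fin L, 2 ^ (i : ℕ) * t i ^ 2 ≤ 2 * B ^ 2)
    (hu : ∑ i : Fin L, 2 ^ (i : ℕ) * u i ^ 2 ≤ 2 * C ^ 2)
    (φ : Fin L → Fin L → Fin L → ℝ)
    (h0 : ∀ i j k : Fin L, (2 : ℝ) ^ (i : ℕ) ≤ ρ * (2 ^ (j : ℕ) * 2 ^ (k : ℕ)) →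
      (2 : ℝ) ^ (j : ℕ) ≤ ρ * (2 ^ (i : ℕ) * 2 ^ (k : ℕ)) →
      (2 : ℝ) ^ (k : ℕ) ≤ ρ * (2 ^ (i : ℕ) * 2 ^ (j : ℕ)) →
      φ i j k ≤ M * ((√(2 ^ (i : ℕ)) * s i) * (√(2 ^ (j : ℕ)) * t j) * (√(2 ^ (k : ℕ)) * u k)))
    (h1 : ∀ i j k : Fin L, φ i j k ≤
      β * (√(2 ^ (j : ℕ) * 2 ^ (k : ℕ)) * s i * (√(2 ^ (j : ℕ)) * t j) * (√(2 ^ (k : ℕ)) * u k)))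
    (h2 : ∀ i j k : Fin L, φ i j k ≤
      β * (√(2 ^ (i : ℕ) * 2 ^ (k : ℕ)) * t j * (√(2 ^ (i : ℕ)) * s i) * (√(2 ^ (k : ℕ)) * u k)))
    (h3 : ∀ i j k : Fin L, φ i j k ≤
      β * (√(2 ^ (i : ℕ) * 2 ^ (j : ℕ)) * u k * (√(2 ^ (i : ℕ)) * s i) *
        (√(2 ^ (j : ℕ)) * t j))) :
    ∑ i, ∑ j, ∑ k, φ i j k ≤ (M * √(2 * L) ^ 3 + 12 * L / √ρ * β) * (A * B * C) := by
  set P₁ : Fin L → Fin L → Fin L → ℝ := fun i j k =>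
    if ρ * (2 ^ (j : ℕ) * 2 ^ (k : ℕ)) < 2 ^ (i : ℕ) then
        √(2 ^ (j : ℕ) * 2 ^ (k : ℕ)) * s i * (√(2 ^ (j : ℕ)) * t j) * (√(2 ^ (k : ℕ)) * u k)
        else 0 with hP₁
  set P₂ : Fin L → Fin L → Fin L → ℝ := fun i j k =>
    if ρ * (2 ^ (i : ℕ) * 2 ^ (k : ℕ)) < 2 ^ (j : ℕ) then
        √(2 ^ (i : ℕ) * 2 ^ (k : ℕ)) * t j * (√(2 ^ (i : ℕ)) * s i) * (√(2 ^ (k : ℕ)) * u k)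
        else 0 with hP₂
  set P₃ : Fin L → Fin L → Fin L → ℝ := fun i j k =>
    if ρ * (2 ^ (i : ℕ) * 2 ^ (j : ℕ)) < 2 ^ (k : ℕ) then
        √(2 ^ (i : ℕ) * 2 ^ (j : ℕ)) * u k * (√(2 ^ (i : ℕ)) * s i) * (√(2 ^ (j : ℕ)) * t j)
        else 0 with hP₃
  have n1 : ∀ i j k, 0 ≤ P₁ i j k := fun i j k => by
    have := hs0 i; have := ht0 j; have := hu0 k
    simp only [hP₁]; split_ifs <;> positivity
  have n2 : ∀ i j k, 0 ≤ P₂ i j k := fun i j k => by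
    have := hs0 i; have := ht0 j; have := hu0 k
    simp only [hP₂]; split_ifs <;> positivity
  have n3 : ∀ i j k, 0 ≤ P₃ i j k := fun i j k => by
    have := hs0 i; have := ht0 j; have := hu0 k
    simp only [hP₃]; split_ifs <;> positivity
  set R : Fin L → Fin L → Fin L → ℝ := fun i j k =>
    (√(2 ^ (i : ℕ)) * s i) * (√(2 ^ (j : ℕ)) * t j) * (√(2 ^ (k : ℕ)) * u k) with hR
  have hpt : ∀ i j k, φ i j k ≤ M * R i j k + β * P₁ i j k + β * P₂ i j k + β * P₃ i j k := by
    intro i j k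
    have m1 := mul_nonneg hβ (n1 i j k)
    have m2 := mul_nonneg hβ (n2 i j k)
    have m3 := mul_nonneg hβ (n3 i j k)
    have m0 : 0 ≤ M * R i j k := by
      have := hs0 i; have := ht0 j; have := hu0 k
      simp only [hR]; positivity
    by_cases c1 : ρ * (2 ^ (j : ℕ) * 2 ^ (k : ℕ)) < (2 : ℝ) ^ (i : ℕ)
    · have := h1 i j k
      have e : P₁ i j k = _ := if_pos c1
      rw [← e] at this
      linarith
    by_cases c2 : ρ * (2 ^ (i : ℕ) * 2 ^ (k : ℕ)) < (2 : ℝ) ^ (j : ℕ)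
    · have := h2 i j k
      have e : P₂ i j k = _ := if_pos c2
      rw [← e] at this
      linarith
    by_cases c3 : ρ * (2 ^ (i : ℕ) * 2 ^ (j : ℕ)) < (2 : ℝ) ^ (k : ℕ)
    · have := h3 i j k
      have e : P₃ i j k = _ := if_pos c3
      rw [← e] at this
      linarith
    have := h0 i j k (not_lt.1 c1) (not_lt.1 c2) (not_lt.1 c3)
    linarith
  have s1 : ∑ i, ∑ j, ∑ k, P₁ i j k ≤ 4 * L / √ρ * (A * B * C) := by
    refine le_trans (le_of_eq ?_) (sum_unbalanced_le hρ ht0 hu0 hA hB hC hs ht hu)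
    rw [Finset.sum_comm]
    refine Finset.sum_congr rfl fun j _ => ?_
    rw [Finset.sum_comm]
  have s2 : ∑ i, ∑ j, ∑ k, P₂ i j k ≤ 4 * L / √ρ * (B * A * C) := by
    refine le_trans (le_of_eq ?_) (sum_unbalanced_le hρ hs0 hu0 hB hA hC ht hs hu)
    refine Finset.sum_congr rfl fun j _ => ?_
    rw [Finset.sum_comm]
  have s3 : ∑ i, ∑ j, ∑ k, P₃ i j k ≤ 4 * L / √ρ * (C * A * B) :=
    sum_unbalanced_le hρ hs0 ht0 hC hA hB hu hs ht
  have s0 : ∑ i, ∑ j, ∑ k, R i j k ≤ √(2 * L) ^ 3 * (A * B * C) := by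
    have ha := sum_sqrt_mul_le hA hs
    have hb := sum_sqrt_mul_le hB ht
    have hc := sum_sqrt_mul_le hC hu
    calc _ = (∑ i : Fin L, √(2 ^ (i : ℕ)) * s i) * (∑ j : Fin L, √(2 ^ (j : ℕ)) * t j) *
          ∑ k : Fin L, √(2 ^ (k : ℕ)) * u k := by
          simp only [hR, ← Finset.mul_sum, ← Finset.sum_mul]
      _ ≤ (√(2 * L) * A) * (√(2 * L) * B) * (√(2 * L) * C) := by
          have e2 : 0 ≤ ∑ j : Fin L, √(2 ^ (j : ℕ)) * t j :=
            Finset.sum_nonneg fun k _ => mul_nonneg (Real.sqrt_nonneg _) (ht0 k)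
          have e3 : 0 ≤ ∑ j : Fin L, √(2 ^ (j : ℕ)) * u j :=
            Finset.sum_nonneg fun k _ => mul_nonneg (Real.sqrt_nonneg _) (hu0 k)
          gcongr
      _ = _ := by ring
  calc ∑ i, ∑ j, ∑ k, φ i j k
      ≤ ∑ i, ∑ j, ∑ k, (M * R i j k + β * P₁ i j k + β * P₂ i j k + β * P₃ i j k) :=
        Finset.sum_le_sum fun i _ => Finset.sum_le_sum fun j _ => Finset.sum_le_sum fun k _ =>
          hpt i j k
    _ = M * ∑ i, ∑ j, ∑ k, R i j k + β * ∑ i, ∑ j, ∑ k, P₁ i j k +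
        β * ∑ i, ∑ j, ∑ k, P₂ i j k + β * ∑ i, ∑ j, ∑ k, P₃ i j k := by
        simp only [Finset.sum_add_distrib, Finset.mul_sum]
    _ ≤ M * (√(2 * L) ^ 3 * (A * B * C)) + β * (4 * L / √ρ * (A * B * C)) +
        β * (4 * L / √ρ * (B * A * C)) + β * (4 * L / √ρ * (C * A * B)) := by gcongr
    _ = _ := by ring

/-! ### Bootstrapping to a Frobenius norm bound -/

theorem sqrt_balanced_le {K p q r : ℕ} {ρ : ℝ} (hρ : 1 ≤ ρ) (hp : p ≤ K) (hq : q ≤ K) (hr : r ≤ K)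
    (h1 : (p : ℝ) ≤ ρ * (q * r)) (h2 : (q : ℝ) ≤ ρ * (p * r)) (h3 : (r : ℝ) ≤ ρ * (p * q)) :
    √((2 * (K * (p + q + r)) : ℕ) : ℝ) * √((K * (p + q + r) + p * (q * r) : ℕ) : ℝ) ≤
      5 * K * √ρ * (√p * √q * √r) := by
  rw [← Real.sqrt_mul (by positivity)]
  have e : 5 * K * √ρ * (√p * √q * √r) = √(25 * (K : ℝ) ^ 2 * ρ * (p * q * r)) := by
    rw [Real.sqrt_mul (by positivity), Real.sqrt_mul (by positivity), Real.sqrt_mul (by positivity),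
      Real.sqrt_mul (by positivity), Real.sqrt_mul (by positivity), Real.sqrt_sq (by positivity),
      show (25 : ℝ) = 5 ^ 2 by norm_num, Real.sqrt_sq (by norm_num)]
  rw [e]
  refine Real.sqrt_le_sqrt ?_
  push_cast
  have hp' : (p : ℝ) ≤ K := by exact_mod_cast hp
  have hq' : (q : ℝ) ≤ K := by exact_mod_cast hq
  have hr' : (r : ℝ) ≤ K := by exact_mod_cast hr
  have p0 : (0 : ℝ) ≤ p := Nat.cast_nonneg p
  have q0 : (0 : ℝ) ≤ q := Nat.cast_nonneg q
  have r0 : (0 : ℝ) ≤ r := Nat.cast_nonneg r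
  have k0 : (0 : ℝ) ≤ K := Nat.cast_nonneg K
  set x : ℝ := (p : ℝ)
  set y : ℝ := (q : ℝ)
  set z : ℝ := (r : ℝ)
  set k : ℝ := (K : ℝ)
  -- Balance is exactly what bounds the square of each rank by ρ times the product of all three.
  have a1 : x ^ 2 ≤ ρ * (x * y * z) := by nlinarith
  have a2 : y ^ 2 ≤ ρ * (x * y * z) := by nlinarith
  have a3 : z ^ 2 ≤ ρ * (x * y * z) := by nlinarith
  have a4 : (x + y + z) ^ 2 ≤ 9 * (ρ * (x * y * z)) := by
    nlinarith [sq_nonneg (x - y), sq_nonneg (y - z), sq_nonneg (x - z)]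
  have a5 : x * y * z ≤ ρ * (x * y * z) := le_mul_of_one_le_left (by positivity) hρ
  have a6 : k * (x + y + z) ≤ 3 * k ^ 2 := by nlinarith
  calc 2 * (k * (x + y + z)) * (k * (x + y + z) + x * (y * z))
      = 2 * k ^ 2 * (x + y + z) ^ 2 + 2 * (k * (x + y + z)) * (x * y * z) := by ring
    _ ≤ 2 * k ^ 2 * (9 * (ρ * (x * y * z))) + 2 * (3 * k ^ 2) * (ρ * (x * y * z)) := by
        gcongr
    _ = 24 * (k ^ 2 * ρ * (x * y * z)) := by ring
    _ ≤ 25 * (k ^ 2 * ρ * (x * y * z)) := by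
        gcongr; norm_num
    _ = _ := by ring

/-- A bound up to half of itself can be absorbed. -/
theorem le_two_mul_of_absorb {φ D β F : ℝ}
    (h : ∀ k : ℕ, φ ≤ (2 * D + β / 2 ^ k) * F) : φ ≤ 2 * D * F := by
  have h1 : Filter.Tendsto (fun k : ℕ => (2 * D + β / 2 ^ k) * F) Filter.atTop
      (nhds ((2 * D + 0) * F)) := by
    refine Filter.Tendsto.mul_const _ (Filter.Tendsto.const_add _ ?_)
    exact tendsto_const_nhds.div_atTop (tendsto_pow_atTop_atTop_of_one_lt (by norm_num))
  have := ge_of_tendsto' h1 h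
  simpa using this

/-- Sign tensors for which the trilinear form is small for the Frobenius norms. -/
theorem exists_sign_tensors_froNorm_le (m : ℕ) {K : ℕ} (hK : K = 2 ^ m) :
    ∃ g h : Fin K × Fin K × Fin K → ℝ, (∀ j, g j = 1 ∨ g j = -1) ∧ (∀ j, h j = 1 ∨ h j = -1) ∧
      ∀ X Y Z : Matrix (Fin K) (Fin K) ℝ, |triForm g h X Y Z| ≤
        2 * (46080 * K * (24 * (m + 1 : ℕ)) * √(2 * (m + 1 : ℕ)) ^ 3) *
          (froNorm X * froNorm Y * froNorm Z) := by
  obtain ⟨g, h, hg, hh, hgh⟩ := exists_sign_tensors_form_le m hK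
  refine ⟨g, h, hg, hh, ?_⟩
  set L := m + 1 with hL
  have hL1 : (1 : ℝ) ≤ L := by rw [hL]; push_cast; linarith [(Nat.cast_nonneg m : (0 : ℝ) ≤ m)]
  -- Chosen so that the unbalanced loss 12L/√ρ equals 1/2.
  set ρ : ℝ := (24 * L) ^ 2 with hρdef
  have hρ : 1 ≤ ρ := by rw [hρdef]; nlinarith
  have hsρ : √ρ = 24 * L := Real.sqrt_sq (by positivity)
  set D : ℝ := 46080 * K * (24 * L) * √(2 * L) ^ 3 with hD
  have hD0 : 0 ≤ D := by positivity
  -- Any valid bound β improves to D + β/2: D comes from the balanced triples, where 46080 = 9216 ·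
  -- 5, and β/2 from feeding β into the rank reduction.
  have step : ∀ β : ℝ, 0 ≤ β →
      (∀ X Y Z, |triForm g h X Y Z| ≤ β * (froNorm X * froNorm Y * froNorm Z)) →
      ∀ X Y Z, |triForm g h X Y Z| ≤ (D + β / 2) * (froNorm X * froNorm Y * froNorm Z) := by
    intro β hβ0 hβ X Y Z
    obtain ⟨U, U', s, rfl, hU, hU', hs0, hs⟩ := exists_dyadic_decomposition m hK X
    obtain ⟨V, V', t, rfl, hV, hV', ht0, ht⟩ := exists_dyadic_decomposition m hK Y
    obtain ⟨W, W', u, rfl, hW, hW', hu0, hu⟩ := exists_dyadic_decomposition m hK Z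
    have hsum : |triForm g h (∑ l, U l * (U' l)ᵀ) (∑ l, V l * (V' l)ᵀ) (∑ l, W l * (W' l)ᵀ)| ≤
        ∑ i, ∑ j, ∑ k, |triForm g h (U i * (U' i)ᵀ) (V j * (V' j)ᵀ) (W k * (W' k)ᵀ)| := by
      rw [triForm_sum₁]
      refine (Finset.abs_sum_le_sum_abs _ _).trans (Finset.sum_le_sum fun i _ => ?_)
      rw [triForm_sum₂]
      refine (Finset.abs_sum_le_sum_abs _ _).trans (Finset.sum_le_sum fun j _ => ?_)
      rw [triForm_sum₃]
      exact Finset.abs_sum_le_sum_abs _ _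
    refine hsum.trans ?_
    have hop : ∀ (l : ℕ) (U U' : Matrix (Fin K) (Fin l) ℝ) (s : ℝ), ‖U‖ ≤ s → ‖U'‖ ≤ 1 →
        ‖U * U'ᵀ‖ ≤ s := by
      intro l U U' s h1 h2
      calc _ ≤ ‖U‖ * ‖U'ᵀ‖ := Matrix.l2_opNorm_mul _ _
        _ ≤ s * 1 := by
          rw [Matrix.l2_opNorm_transpose]
          exact mul_le_mul h1 h2 (norm_nonneg _) ((norm_nonneg _).trans h1)
        _ = s := mul_one s
    have hfX : ∀ i, froNorm (U i * (U' i)ᵀ) ≤ √(2 ^ (i : ℕ)) * s i := fun i => by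
      simpa using froNorm_mul_transpose_le (hU i) (hU' i)
    have hfY : ∀ i, froNorm (V i * (V' i)ᵀ) ≤ √(2 ^ (i : ℕ)) * t i := fun i => by
      simpa using froNorm_mul_transpose_le (hV i) (hV' i)
    have hfZ : ∀ i, froNorm (W i * (W' i)ᵀ) ≤ √(2 ^ (i : ℕ)) * u i := fun i => by
      simpa using froNorm_mul_transpose_le (hW i) (hW' i)
    refine (sum_triple_le (ρ := ρ) (M := 46080 * K * √ρ) (β := β) (by linarith) (by positivity) hβ0
      hs0 ht0 hu0 (froNorm_nonneg _) (froNorm_nonneg _) (froNorm_nonneg _) hs ht hu _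
      ?_ ?_ ?_ ?_).trans (le_of_eq ?_)
    · intro i j k c1 c2 c3
      refine (hgh i j k (U i) (U' i) (V j) (V' j) (W k) (W' k)).trans ?_
      have hpow : ∀ i : Fin (m + 1), 2 ^ (i : ℕ) ≤ K := fun i =>
        hK ▸ Nat.pow_le_pow_right (by norm_num) (by omega)
      have hb := sqrt_balanced_le hρ (hpow i) (hpow j) (hpow k) (by exact_mod_cast c1)
        (by exact_mod_cast c2) (by exact_mod_cast c3)
      have hn : ‖U i‖ * ‖V j‖ * ‖W k‖ * (‖U' i‖ * ‖V' j‖ * ‖W' k‖) ≤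
          s i * t j * u k * (1 * 1 * 1) := by
        have := hs0 i; have := ht0 j; have := hu0 k
        gcongr
        exacts [hU i, hV j, hW k, hU' i, hV' j, hW' k]
      rw [mul_assoc (9216 : ℝ)]
      have := hs0 i; have := ht0 j; have := hu0 k
      refine (mul_le_mul (mul_le_mul_of_nonneg_left hb (by norm_num)) hn (by positivity)
        (by positivity)).trans (le_of_eq ?_)
      push_cast
      ring
    · intro i j k
      refine (abs_triForm_mul_transpose_le g h _ hβ0 hβ _ _ _ _).trans ?_
      have e1 := hop _ _ _ _ (hU i) (hU' i)
      have e2 := hfY j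
      have e3 := hfZ k
      have e4 := hs0 i
      have e5 := ht0 j
      have e6 := hu0 k
      have e7 := froNorm_nonneg (V j * (V' j)ᵀ)
      have e8 := froNorm_nonneg (W k * (W' k)ᵀ)
      rw [Nat.cast_mul, Nat.cast_pow, Nat.cast_pow, Nat.cast_ofNat]
      gcongr
    · intro i j k
      rw [triForm_swap₁₂]
      refine (abs_triForm_mul_transpose_le _ _ _ hβ0 (fun X Y Z => ?_) _ _ _ _).trans ?_
      · have := hβ Y X Z
        rw [triForm_swap₁₂] at this
        refine this.trans (le_of_eq ?_)
        ring
      have e1 := hop _ _ _ _ (hV j) (hV' j)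
      have e2 := hfX i
      have e3 := hfZ k
      have e4 := hs0 i
      have e5 := ht0 j
      have e6 := hu0 k
      have e7 := froNorm_nonneg (U i * (U' i)ᵀ)
      have e8 := froNorm_nonneg (W k * (W' k)ᵀ)
      rw [Nat.cast_mul, Nat.cast_pow, Nat.cast_pow, Nat.cast_ofNat]
      gcongr
    · intro i j k
      rw [triForm_swap₁₃]
      have h1 := abs_triForm_mul_transpose_le (g ∘ prodSwap₁₃ _ _ _) (h ∘ prodSwap₁₃ _ _ _)
        (W k * (W' k)ᵀ) hβ0 (fun X Y Z => by
          have := hβ Z Y X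
          rw [triForm_swap₁₃] at this
          refine this.trans (le_of_eq ?_)
          ring) (V j) (V' j) (U i) (U' i)
      refine h1.trans ?_
      have e1 := hfX i
      have e2 := hfY j
      have e3 := hop _ _ _ _ (hW k) (hW' k)
      have e4 := hs0 i
      have e5 := ht0 j
      have e6 := hu0 k
      have e7 := froNorm_nonneg (U i * (U' i)ᵀ)
      have e8 := froNorm_nonneg (V j * (V' j)ᵀ)
      calc _ ≤ β * (√((2 ^ (j : ℕ) * 2 ^ (i : ℕ) : ℕ) : ℝ) * u k * (√(2 ^ (j : ℕ)) * t j) *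
            (√(2 ^ (i : ℕ)) * s i)) := by gcongr
        _ = _ := by push_cast; rw [mul_comm ((2 : ℝ) ^ (j : ℕ))]; ring
    · rw [hsρ, hD]
      have h1 : 12 * ((m + 1 : ℕ) : ℝ) / (24 * L) = 1 / 2 := by
        rw [hL]; field_simp; norm_num
      rw [h1]
      ring
  -- A crude finite bound starts the iteration; its size is irrelevant because it is halved at every
  -- step.
  set β₀ : ℝ := ∑ x, ∑ y, |g x * h y| with hβ₀
  have hβ₀0 : 0 ≤ β₀ := Finset.sum_nonneg fun _ _ => Finset.sum_nonneg fun _ _ => abs_nonneg _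
  have iter : ∀ k : ℕ, ∀ X Y Z, |triForm g h X Y Z| ≤
      (2 * D + β₀ / 2 ^ k) * (froNorm X * froNorm Y * froNorm Z) := by
    intro k
    induction k with
    | zero =>
      intro X Y Z
      refine (abs_triForm_le g h X Y Z).trans ?_
      have := froNorm_nonneg X
      have := froNorm_nonneg Y
      have := froNorm_nonneg Z
      gcongr
      rw [pow_zero, div_one]
      linarith
    | succ k ih =>
      intro X Y Z
      refine (step _ (by positivity) ih X Y Z).trans (le_of_eq ?_)
      rw [pow_succ]
      ring
  intro X Y Z
  exact le_two_mul_of_absorb fun k => iter k X Y Z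

end SpectralNorm

/-! ### Orthogonality and completeness of Pauli strings -/

theorem sum_comm_pairs {α β γ δ R : Type*} [Fintype α] [Fintype β] [Fintype γ] [Fintype δ]
    [AddCommMonoid R] (f : α → β → γ → δ → R) :
    ∑ x, ∑ y, ∑ s, ∑ t, f x y s t = ∑ s, ∑ t, ∑ x, ∑ y, f x y s t := by
  calc _ = ∑ x, ∑ s, ∑ t, ∑ y, f x y s t := Finset.sum_congr rfl fun x _ => by
        rw [Finset.sum_comm]
        exact Finset.sum_congr rfl fun s _ => Finset.sum_comm
    _ = ∑ s, ∑ x, ∑ t, ∑ y, f x y s t := Finset.sum_comm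
    _ = _ := Finset.sum_congr rfl fun s _ => Finset.sum_comm

section pauli

variable {n : ℕ}

theorem sum_pow_two_fin_prod (f : Fin n → Fin 2 → ℂ) :
    ∑ x : Fin (2 ^ n), ∏ k, f k (finFunctionFinEquiv.symm x k) = ∏ k, ∑ a, f k a := by
  rw [Fintype.prod_sum]
  exact Fintype.sum_equiv finFunctionFinEquiv.symm _ _ fun x => rfl

theorem prod_ite_eq_finFunctionFinEquiv (x y : Fin (2 ^ n)) :
    (∏ k, if finFunctionFinEquiv.symm x k = finFunctionFinEquiv.symm y k then (1 : ℂ) else 0) =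
      if x = y then 1 else 0 := by
  by_cases h : x = y
  · simp [h]
  · rw [if_neg h]
    obtain ⟨k, hk⟩ := Function.ne_iff.1 fun h' => h (finFunctionFinEquiv.symm.injective h')
    exact Finset.prod_eq_zero (Finset.mem_univ k) (if_neg hk)

theorem pauliMatrix_isHermitian (i : Fin 4) (a b : Fin 2) :
    star (pauliMatrix i a b) = pauliMatrix i b a := by
  fin_cases i <;> fin_cases a <;> fin_cases b <;> simp [pauliMatrix]

theorem pauliMatrix_sq (i : Fin 4) (a b : Fin 2) :
    ∑ c, pauliMatrix i a c * pauliMatrix i c b = if a = b then 1 else 0 := by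
  fin_cases i <;> fin_cases a <;> fin_cases b <;> simp [pauliMatrix]

theorem pauliMatrix_completeness (a b c d : Fin 2) :
    ∑ i, pauliMatrix i a b * pauliMatrix i c d =
      2 * ((if a = d then 1 else 0) * if b = c then 1 else 0) := by
  fin_cases a <;> fin_cases b <;> fin_cases c <;> fin_cases d <;>
    simp [pauliMatrix, Fin.sum_univ_four] <;> norm_num

theorem pauliMatrix_orthogonality (i j : Fin 4) :
    ∑ a, ∑ b, pauliMatrix i a b * pauliMatrix j b a = if i = j then 2 else 0 := by
  fin_cases i <;> fin_cases j <;> simp [pauliMatrix] <;> norm_num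

theorem pauliString_isHermitian (s : Fin n → Fin 4) : (pauliString s).IsHermitian := by
  ext x y
  simp only [Matrix.conjTranspose_apply, pauliString, Matrix.of_apply, star_prod,
    pauliMatrix_isHermitian]

theorem pauliString_mul_self (s : Fin n → Fin 4) : pauliString s * pauliString s = 1 := by
  ext x z
  simp only [Matrix.mul_apply, pauliString, Matrix.of_apply, ← Finset.prod_mul_distrib]
  rw [sum_pow_two_fin_prod fun k c => pauliMatrix (s k) (finFunctionFinEquiv.symm x k) c *
    pauliMatrix (s k) c (finFunctionFinEquiv.symm z k)]
  simp only [pauliMatrix_sq, Matrix.one_apply]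
  exact prod_ite_eq_finFunctionFinEquiv x z

/-- The sum of P ⊗ P over all strings is 2^n times the swap; this factors over the n qubits. It
makes the entangled score computable. -/
theorem pauliString_completeness (x y v w : Fin (2 ^ n)) :
    ∑ s : Fin n → Fin 4, pauliString s x y * pauliString s v w =
      2 ^ n * ((if x = w then 1 else 0) * if y = v then 1 else 0) := by
  simp only [pauliString, Matrix.of_apply, ← Finset.prod_mul_distrib]
  rw [← Fintype.prod_sum fun k i => pauliMatrix i (finFunctionFinEquiv.symm x k)
    (finFunctionFinEquiv.symm y k) * pauliMatrix i (finFunctionFinEquiv.symm v k)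
    (finFunctionFinEquiv.symm w k)]
  simp only [pauliMatrix_completeness, Finset.prod_mul_distrib, prod_ite_eq_finFunctionFinEquiv,
    Finset.prod_const, Finset.card_univ, Fintype.card_fin]

theorem pauliString_orthogonality (s t : Fin n → Fin 4) :
    ∑ x, ∑ y, pauliString s x y * pauliString t y x = if s = t then 2 ^ n else 0 := by
  simp only [pauliString, Matrix.of_apply, ← Finset.prod_mul_distrib]
  have h1 : ∀ x : Fin (2 ^ n), ∑ y : Fin (2 ^ n), ∏ k,
      pauliMatrix (s k) (finFunctionFinEquiv.symm x k) (finFunctionFinEquiv.symm y k) *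
      pauliMatrix (t k) (finFunctionFinEquiv.symm y k) (finFunctionFinEquiv.symm x k) =
      ∏ k, ∑ b, pauliMatrix (s k) (finFunctionFinEquiv.symm x k) b *
        pauliMatrix (t k) b (finFunctionFinEquiv.symm x k) := fun x =>
    sum_pow_two_fin_prod fun k b => pauliMatrix (s k) (finFunctionFinEquiv.symm x k) b *
        pauliMatrix (t k) b (finFunctionFinEquiv.symm x k)
  simp_rw [h1]
  rw [sum_pow_two_fin_prod fun k a => ∑ b, pauliMatrix (s k) a b * pauliMatrix (t k) b a]
  simp only [pauliMatrix_orthogonality]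
  by_cases h : s = t
  · simp [h]
  · rw [if_neg h]
    obtain ⟨k, hk⟩ := Function.ne_iff.1 h
    exact Finset.prod_eq_zero (Finset.mem_univ k) (if_neg hk)

theorem pauliString_isObservable (s : Fin n → Fin 4) : IsObservable (pauliString s) := by
  refine ⟨pauliString_isHermitian s, fun μ hμ => ?_⟩
  have h := spectrum.pow_mem_pow (𝕜 := ℂ) (pauliString s) 2 hμ
  rw [sq (pauliString s), pauliString_mul_self, spectrum.one_eq] at h
  exact mul_self_eq_one_iff.1 (by rw [← sq]; exact h)

/-- By orthogonality each of the 4^n strings contributes 2^n, whatever the signs; this is all that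
is used about classical strategies. -/
theorem sum_normSq_sum_smul_pauliString (χ : (Fin n → Fin 4) → ℝ) (hχ : ∀ s, χ s ^ 2 = 1) :
    ∑ x, ∑ y, Complex.normSq (∑ s, (χ s : ℂ) * pauliString s x y) = (2 ^ n : ℝ) ^ 3 := by
  have h : (((∑ x, ∑ y, Complex.normSq (∑ s, (χ s : ℂ) * pauliString s x y) : ℝ)) : ℂ) =
      (2 ^ n : ℂ) ^ 3 := by
    push_cast
    have h1 : ∀ x y, (Complex.normSq (∑ s, (χ s : ℂ) * pauliString s x y) : ℂ) =
        ∑ s, ∑ t, (χ s : ℂ) * χ t * (pauliString s x y * pauliString t y x) := by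
      intro x y
      rw [← Complex.mul_conj, map_sum, Finset.sum_mul_sum]
      refine Finset.sum_congr rfl fun s _ => Finset.sum_congr rfl fun t _ => ?_
      rw [map_mul, Complex.conj_ofReal, ← (pauliString_isHermitian t).apply y x]
      simp only [RCLike.star_def]
      ring
    simp_rw [h1]
    calc _ = ∑ s, ∑ t, (χ s : ℂ) * χ t * ∑ x, ∑ y, (pauliString s x y * pauliString t y x) := by
          simp only [Finset.mul_sum]
          exact sum_comm_pairs _
      _ = ∑ s : Fin n → Fin 4, (2 ^ n : ℂ) := by
          refine Finset.sum_congr rfl fun s _ => ?_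
          simp only [pauliString_orthogonality, mul_ite, mul_zero, Finset.sum_ite_eq,
            Finset.mem_univ, if_true]
          have : (χ s : ℂ) * χ s = 1 := by
            have := hχ s
            rw [sq] at this
            exact_mod_cast this
          rw [this, one_mul]
      _ = _ := by
          rw [Finset.sum_const, Finset.card_univ, Fintype.card_fun, Fintype.card_fin,
            Fintype.card_fin, nsmul_eq_mul]
          push_cast
          rw [show (4 : ℂ) = 2 ^ 2 by norm_num, ← pow_mul]
          ring
  exact_mod_cast h

end pauli

/-! ### Observables and boundedness of the entangled values -/

section observable

variable {d : ℕ}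

theorem IsObservable.mul_self {A : Matrix (Fin d) (Fin d) ℂ} (hA : IsObservable A) :
    A * A = 1 := by
  obtain ⟨hH, hs⟩ := hA
  have h1 : ∀ i, hH.eigenvalues i * hH.eigenvalues i = 1 := by
    intro i
    have h2 := hs _ ((spectrum.algebraMap_mem_iff ℂ).2 (hH.eigenvalues_mem_spectrum_real i))
    simp only [Complex.coe_algebraMap] at h2
    rcases h2 with h2 | h2
    · have : hH.eigenvalues i = 1 := by exact_mod_cast h2
      rw [this]; norm_num
    · have : hH.eigenvalues i = -1 := by exact_mod_cast h2
      rw [this]; norm_num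
  rw [hH.spectral_theorem, ← map_mul, Matrix.diagonal_mul_diagonal]
  have h3 : (Matrix.diagonal fun i => (RCLike.ofReal ∘ hH.eigenvalues) i *
      (RCLike.ofReal ∘ hH.eigenvalues) i : Matrix (Fin d) (Fin d) ℂ) = 1 := by
    rw [← Matrix.diagonal_one]
    congr 1
    ext i
    rw [Function.comp_apply, ← RCLike.ofReal_mul, h1 i, RCLike.ofReal_one]
  rw [h3, map_one]

theorem IsObservable.mem_unitary {A : Matrix (Fin d) (Fin d) ℂ} (hA : IsObservable A) :
    A ∈ unitary (Matrix (Fin d) (Fin d) ℂ) := by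
  have : star A = A := hA.1
  rw [Unitary.mem_iff, this]
  exact ⟨hA.mul_self, hA.mul_self⟩

theorem norm_star_dotProduct_mulVec_le {ι : Type*} [Fintype ι] [DecidableEq ι] {U : Matrix ι ι ℂ}
    (hU : U ∈ unitary (Matrix ι ι ℂ)) (ψ : EuclideanSpace ℂ ι) :
    ‖star ψ.ofLp ⬝ᵥ (U *ᵥ ψ.ofLp)‖ ≤ ‖ψ‖ ^ 2 := by
  set φ : EuclideanSpace ℂ ι := WithLp.toLp 2 (U *ᵥ ψ.ofLp) with hφ
  have h1 : star ψ.ofLp ⬝ᵥ (U *ᵥ ψ.ofLp) = inner ℂ ψ φ := by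
    rw [EuclideanSpace.inner_eq_star_dotProduct, dotProduct_comm]
  have h2 : ‖φ‖ = ‖ψ‖ := by
    have h3 : inner ℂ φ φ = inner ℂ ψ ψ := by
      rw [EuclideanSpace.inner_eq_star_dotProduct, EuclideanSpace.inner_eq_star_dotProduct,
        dotProduct_comm, dotProduct_comm ψ.ofLp]
      simp only [hφ]
      rw [Matrix.star_mulVec, ← Matrix.dotProduct_mulVec, Matrix.mulVec_mulVec,
        ← Matrix.star_eq_conjTranspose, hU.1, Matrix.one_mulVec]
    rw [inner_self_eq_norm_sq_to_K, inner_self_eq_norm_sq_to_K] at h3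
    have h4 : ‖φ‖ ^ 2 = ‖ψ‖ ^ 2 := by exact_mod_cast h3
    exact (sq_eq_sq₀ (norm_nonneg _) (norm_nonneg _)).1 h4
  rw [h1, sq]
  exact (norm_inner_le_norm _ _).trans (by rw [h2])

theorem EntangledStrategy.correlation_mem {Q : ℕ} (S : EntangledStrategy Q d) (a b c : Fin Q) :
    |S.correlation a b c| ≤ 1 := by
  have hU := Matrix.kronecker_mem_unitary (S.isObservable₁ a).mem_unitary
    (Matrix.kronecker_mem_unitary (S.isObservable₂ b).mem_unitary (S.isObservable₃ c).mem_unitary)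
  have h := norm_star_dotProduct_mulVec_le hU S.state
  rw [S.norm_state, one_pow] at h
  exact (Complex.abs_re_le_norm _).trans h

/-- Needed because the supremum defining the entangled bias is meaningful only over a bounded set.
-/
theorem XORGame.entangledValue_le_one {Q : ℕ} (G : XORGame Q) (S : EntangledStrategy Q d) :
    G.entangledValue S ≤ 1 := by
  rw [← G.prob_sum]
  refine Finset.sum_le_sum fun a _ => Finset.sum_le_sum fun b _ => Finset.sum_le_sum fun c _ => ?_
  have h1 := abs_le.1 (S.correlation_mem a b c)
  have h2 := G.prob_nonneg a b c
  rcases Int.units_eq_one_or (G.sign a b c) with h | h <;> rw [h] <;> push_cast <;> nlinarith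

theorem XORGame.entangledValue_le_entangledBias {Q : ℕ} (G : XORGame Q)
    (S : EntangledStrategy Q d) : G.entangledValue S ≤ G.entangledBias :=
  le_csSup ⟨1, by rintro _ ⟨d, S, rfl⟩; exact G.entangledValue_le_one S⟩ ⟨d, S, rfl⟩

end observable

/-! ### Games from real coefficients -/

section generalGame

/-- The game whose signed weights are proportional to given coefficients. -/
noncomputable def XORGame.ofCoeff {Q : ℕ} (c : Fin Q → Fin Q → Fin Q → ℝ)
    (hc : 0 < ∑ i, ∑ j, ∑ k, |c i j k|) : XORGame Q where
  prob i j k := |c i j k| / ∑ i, ∑ j, ∑ k, |c i j k|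
  prob_nonneg i j k := by positivity
  prob_sum := by
    simp only [← Finset.sum_div]
    exact div_self hc.ne'
  sign i j k := if 0 ≤ c i j k then 1 else -1

variable {Q : ℕ} (c : Fin Q → Fin Q → Fin Q → ℝ) (hc : 0 < ∑ i, ∑ j, ∑ k, |c i j k|)

theorem XORGame.ofCoeff_prob_mul_sign (i j k : Fin Q) :
    (XORGame.ofCoeff c hc).prob i j k * (((XORGame.ofCoeff c hc).sign i j k : ℤˣ) : ℤ) =
      c i j k / ∑ i, ∑ j, ∑ k, |c i j k| := by
  simp only [XORGame.ofCoeff]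
  split_ifs with h
  · rw [abs_of_nonneg h]; simp
  · rw [abs_of_neg (not_le.1 h)]
    push_cast
    ring

theorem XORGame.ofCoeff_classicalValue (χ υ ζ : Fin Q → ℤˣ) :
    (XORGame.ofCoeff c hc).classicalValue χ υ ζ =
      (∑ i, ∑ j, ∑ k, c i j k * (((χ i : ℤ) : ℝ) * ((υ j : ℤ) : ℝ) * ((ζ k : ℤ) : ℝ))) /
        ∑ i, ∑ j, ∑ k, |c i j k| := by
  simp only [XORGame.classicalValue, Finset.sum_div]
  refine Finset.sum_congr rfl fun i _ => Finset.sum_congr rfl fun j _ =>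
    Finset.sum_congr rfl fun k _ => ?_
  have h := XORGame.ofCoeff_prob_mul_sign c hc i j k
  simp only [Units.val_mul, Int.cast_mul, ← mul_assoc, h]
  ring

theorem XORGame.ofCoeff_entangledValue {d : ℕ} (S : EntangledStrategy Q d) :
    (XORGame.ofCoeff c hc).entangledValue S =
      (∑ i, ∑ j, ∑ k, c i j k * S.correlation i j k) / ∑ i, ∑ j, ∑ k, |c i j k| := by
  simp only [XORGame.entangledValue, XORGame.ofCoeff_prob_mul_sign, Finset.sum_div]
  refine Finset.sum_congr rfl fun i _ => Finset.sum_congr rfl fun j _ =>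
    Finset.sum_congr rfl fun k _ => ?_
  ring

theorem sum_mul_triple {α β γ R : Type*} [Fintype α] [Fintype β] [Fintype γ] [CommSemiring R]
    (a : α → R) (b : β → R) (c : γ → R) :
    ∑ z : α × β × γ, a z.1 * b z.2.1 * c z.2.2 = (∑ i, a i) * (∑ j, b j) * ∑ k, c k := by
  simp only [Fintype.sum_prod_type, ← Finset.mul_sum, ← Finset.sum_mul]

theorem sum_equiv_triple {α β R : Type*} [Fintype α] [Fintype β] [AddCommMonoid R] (e : α ≃ β)
    (f : β × β × β → R) : ∑ i, ∑ j, ∑ k, f (e i, e j, e k) = ∑ z, f z := by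
  simp only [Fintype.sum_prod_type]
  exact Fintype.sum_equiv e _ _ fun i => Fintype.sum_equiv e _ _ fun j =>
    Fintype.sum_equiv e _ _ fun k => rfl

theorem sum_comp_le_of_injective {α β : Type*} [Fintype α] [Fintype β] {ι : α → β}
    (hι : Function.Injective ι) {f : β → ℝ} (hf : ∀ x, 0 ≤ f x) : ∑ i, f (ι i) ≤ ∑ x, f x := by
  classical
  rw [← Finset.sum_image (s := Finset.univ) (g := ι) fun i _ j _ h => hι h]
  exact Finset.sum_le_univ_sum_of_nonneg hf

/-- A strategy with positive score shows that the coefficients are not all zero, hence can be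
normalised. -/
theorem XORGame.sum_mul_correlation_le {d : ℕ} (S : EntangledStrategy Q d) :
    ∑ i, ∑ j, ∑ k, c i j k * S.correlation i j k ≤ ∑ i, ∑ j, ∑ k, |c i j k| := by
  refine Finset.sum_le_sum fun i _ => Finset.sum_le_sum fun j _ => Finset.sum_le_sum fun k _ => ?_
  refine (le_abs_self _).trans ?_
  rw [abs_mul]
  exact mul_le_of_le_one_right (abs_nonneg _) (S.correlation_mem i j k)

end generalGame

/-! ### The complex form on off-diagonal blocks -/

section cForm

variable {κ ν : Type*} [Fintype κ]

/-- The trilinear form of the off-diagonal blocks of three complex matrices. -/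
noncomputable def cForm (g h : κ × κ × κ → ℝ) (ιA ιB : κ → ν) (X Y Z : Matrix ν ν ℂ) : ℂ :=
  ∑ p : (κ × κ × κ) × (κ × κ × κ), ((g p.1 * h p.2 : ℝ) : ℂ) *
    (X (ιA p.1.1) (ιB p.2.1) * Y (ιA p.1.2.1) (ιB p.2.2.1) * Z (ιA p.1.2.2) (ιB p.2.2.2))

variable (g h : κ × κ × κ → ℝ) (ιA ιB : κ → ν)

theorem cForm_sum {σ : Type*} [Fintype σ] (P : σ → Matrix ν ν ℂ) (a b c : σ → ℂ) :
    cForm g h ιA ιB (Matrix.of fun x y => ∑ s, a s * P s x y)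
      (Matrix.of fun x y => ∑ s, b s * P s x y) (Matrix.of fun x y => ∑ s, c s * P s x y) =
    ∑ z : σ × σ × σ, a z.1 * b z.2.1 * c z.2.2 * cForm g h ιA ιB (P z.1) (P z.2.1) (P z.2.2) := by
  simp only [cForm, Finset.mul_sum]
  rw [Finset.sum_comm]
  refine Finset.sum_congr rfl fun p _ => ?_
  simp only [Matrix.of_apply]
  rw [← sum_mul_triple, Finset.mul_sum]
  exact Finset.sum_congr rfl fun z _ => by ring

theorem froNorm_le_of_sum_normSq [Fintype ν] {ιA ιB : κ → ν} (hA : Function.Injective ιA)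
    (hB : Function.Injective ιB) {X : Matrix ν ν ℂ} {f : ℝ} (hf : 0 ≤ f)
    (hX : ∑ x, ∑ y, Complex.normSq (X x y) ≤ f ^ 2) (φ : ℂ → ℝ)
    (hφ : ∀ z, φ z ^ 2 ≤ Complex.normSq z) :
    froNorm (Matrix.of fun i j => φ (X (ιA i) (ιB j))) ≤ f := by
  refine le_of_sq_le_sq ?_ hf
  rw [froNorm_sq]
  refine le_trans ?_ hX
  calc _ ≤ ∑ i, ∑ j, Complex.normSq (X (ιA i) (ιB j)) :=
        Finset.sum_le_sum fun i _ => Finset.sum_le_sum fun j _ => hφ _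
    _ ≤ ∑ i, ∑ y, Complex.normSq (X (ιA i) y) := Finset.sum_le_sum fun i _ =>
        sum_comp_le_of_injective hB (f := fun y => Complex.normSq (X (ιA i) y))
          fun y => Complex.normSq_nonneg _
    _ ≤ _ := sum_comp_le_of_injective hA (f := fun x => ∑ y, Complex.normSq (X x y))
          fun x => Finset.sum_nonneg fun y _ => Complex.normSq_nonneg _

theorem re_cForm_eq (X Y Z : Matrix ν ν ℂ) :
    let re := fun X : Matrix ν ν ℂ => Matrix.of fun i j => (X (ιA i) (ιB j)).re
    let im := fun X : Matrix ν ν ℂ => Matrix.of fun i j => (X (ιA i) (ιB j)).im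
    (cForm g h ιA ιB X Y Z).re = triForm g h (re X) (re Y) (re Z) - triForm g h (re X) (im Y) (im Z)
      - triForm g h (im X) (re Y) (im Z) - triForm g h (im X) (im Y) (re Z) := by
  intro re im
  simp only [triForm_eq_sum, ← Finset.sum_sub_distrib, cForm, Fintype.sum_prod_type (α₁ := κ × κ × κ)
    (α₂ := κ × κ × κ), Complex.re_sum]
  refine Finset.sum_congr rfl fun x _ => Finset.sum_congr rfl fun y _ => ?_
  rw [Complex.re_ofReal_mul]
  simp only [Complex.mul_re, Complex.mul_im, re, im, Matrix.of_apply]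
  ring

/-- The real part of a product of three complex numbers has four real terms, hence the 4. Passing to
a block and to real or imaginary parts only decreases the Frobenius norm. -/
theorem re_cForm_le [Fintype ν] {ιA ιB : κ → ν} (hA : Function.Injective ιA) (hB : Function.Injective ιB)
    {β f : ℝ} (hβ0 : 0 ≤ β) (hf : 0 ≤ f)
    (hβ : ∀ X Y Z, |triForm g h X Y Z| ≤ β * (froNorm X * froNorm Y * froNorm Z))
    {X Y Z : Matrix ν ν ℂ} (hX : ∑ x, ∑ y, Complex.normSq (X x y) ≤ f ^ 2)
    (hY : ∑ x, ∑ y, Complex.normSq (Y x y) ≤ f ^ 2)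
    (hZ : ∑ x, ∑ y, Complex.normSq (Z x y) ≤ f ^ 2) :
    (cForm g h ιA ιB X Y Z).re ≤ 4 * β * f ^ 3 := by
  have hre : ∀ z : ℂ, z.re ^ 2 ≤ Complex.normSq z := fun z => by
    rw [Complex.normSq_apply]; nlinarith [mul_self_nonneg z.im]
  have him : ∀ z : ℂ, z.im ^ 2 ≤ Complex.normSq z := fun z => by
    rw [Complex.normSq_apply]; nlinarith [mul_self_nonneg z.re]
  have hb : ∀ X Y Z : Matrix κ κ ℝ, froNorm X ≤ f → froNorm Y ≤ f → froNorm Z ≤ f →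
      |triForm g h X Y Z| ≤ β * f ^ 3 := by
    intro X Y Z h1 h2 h3
    refine (hβ X Y Z).trans ?_
    have := froNorm_nonneg X
    have := froNorm_nonneg Y
    have := froNorm_nonneg Z
    calc _ ≤ β * (f * f * f) := by gcongr
      _ = _ := by ring
  have r1 := froNorm_le_of_sum_normSq hA hB hf hX Complex.re hre
  have i1 := froNorm_le_of_sum_normSq hA hB hf hX Complex.im him
  have r2 := froNorm_le_of_sum_normSq hA hB hf hY Complex.re hre
  have i2 := froNorm_le_of_sum_normSq hA hB hf hY Complex.im him
  have r3 := froNorm_le_of_sum_normSq hA hB hf hZ Complex.re hre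
  have i3 := froNorm_le_of_sum_normSq hA hB hf hZ Complex.im him
  rw [re_cForm_eq]
  have t1 := abs_le.1 (hb _ _ _ r1 r2 r3)
  have t2 := abs_le.1 (hb _ _ _ r1 i2 i3)
  have t3 := abs_le.1 (hb _ _ _ i1 r2 i3)
  have t4 := abs_le.1 (hb _ _ _ i1 i2 r3)
  simp only
  linarith [t1.2, t2.1, t3.1, t4.1]

end cForm

/-! ### The entangled score -/

section pauliForm

variable {n : ℕ} {κ : Type*} [Fintype κ]

/-- The expectation of a tensor product of three matrices in a real vector. -/
theorem star_dotProduct_kronecker_mulVec {ν : Type*} [Fintype ν] (φ : ν × ν × ν → ℝ)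
    (P Q R : Matrix ν ν ℂ) :
    star (fun v => (φ v : ℂ)) ⬝ᵥ ((P ⊗ₖ (Q ⊗ₖ R)) *ᵥ fun v => (φ v : ℂ)) =
      ∑ q : (ν × ν × ν) × (ν × ν × ν), ((φ q.1 * φ q.2 : ℝ) : ℂ) *
        (P q.1.1 q.2.1 * Q q.1.2.1 q.2.2.1 * R q.1.2.2 q.2.2.2) := by
  rw [Fintype.sum_prod_type]
  simp only [dotProduct, Matrix.mulVec, Finset.mul_sum]
  refine Finset.sum_congr rfl fun v _ => Finset.sum_congr rfl fun w _ => ?_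
  simp only [Pi.star_apply, RCLike.star_def, Complex.conj_ofReal, Matrix.kroneckerMap_apply]
  push_cast
  ring

/-- Completeness in each tensor factor pairs the (A, B) entry of the form with the (B, A) entry of
the expectation, so the double sum splits into the overlaps of φ with g and with h. -/
theorem sum_cForm_mul_expectation (g h : κ × κ × κ → ℝ) (ιA ιB : κ → Fin (2 ^ n))
    (φ : Fin (2 ^ n) × Fin (2 ^ n) × Fin (2 ^ n) → ℝ) :
    ∑ z : (Fin n → Fin 4) × (Fin n → Fin 4) × (Fin n → Fin 4),
      cForm g h ιA ιB (pauliString z.1) (pauliString z.2.1) (pauliString z.2.2) *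
      (star (fun v => (φ v : ℂ)) ⬝ᵥ ((pauliString z.1 ⊗ₖ (pauliString z.2.1 ⊗ₖ
        pauliString z.2.2)) *ᵥ fun v => (φ v : ℂ))) =
    (((2 ^ n) ^ 3 * ((∑ x, g x * φ (ιA x.1, ιA x.2.1, ιA x.2.2)) *
      ∑ y, h y * φ (ιB y.1, ιB y.2.1, ιB y.2.2)) : ℝ) : ℂ) := by
  simp only [star_dotProduct_kronecker_mulVec, cForm, Finset.sum_mul_sum]
  rw [Finset.sum_comm]
  have h1 : ∀ (p : (κ × κ × κ) × (κ × κ × κ)) (q : (Fin (2 ^ n) × Fin (2 ^ n) × Fin (2 ^ n)) ×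
      (Fin (2 ^ n) × Fin (2 ^ n) × Fin (2 ^ n))),
      ∑ z : (Fin n → Fin 4) × (Fin n → Fin 4) × (Fin n → Fin 4),
        (pauliString z.1 (ιA p.1.1) (ιB p.2.1) * pauliString z.2.1 (ιA p.1.2.1) (ιB p.2.2.1) *
          pauliString z.2.2 (ιA p.1.2.2) (ιB p.2.2.2)) *
        (pauliString z.1 q.1.1 q.2.1 * pauliString z.2.1 q.1.2.1 q.2.2.1 *
          pauliString z.2.2 q.1.2.2 q.2.2.2) =
      if q = ((ιB p.2.1, ιB p.2.2.1, ιB p.2.2.2), (ιA p.1.1, ιA p.1.2.1, ιA p.1.2.2))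
        then ((2 : ℂ) ^ n) ^ 3 else 0 := by
    intro p q
    have h2 := sum_mul_triple
      (fun s : Fin n → Fin 4 => pauliString s (ιA p.1.1) (ιB p.2.1) * pauliString s q.1.1 q.2.1)
      (fun s : Fin n → Fin 4 => pauliString s (ιA p.1.2.1) (ιB p.2.2.1) *
        pauliString s q.1.2.1 q.2.2.1)
      (fun s : Fin n → Fin 4 => pauliString s (ιA p.1.2.2) (ιB p.2.2.2) *
        pauliString s q.1.2.2 q.2.2.2)
    simp only [pauliString_completeness] at h2
    refine Eq.trans (Finset.sum_congr rfl fun z _ => by ring) (h2.trans ?_)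
    obtain ⟨⟨v1, v2, v3⟩, ⟨w1, w2, w3⟩⟩ := q
    simp only [Prod.mk.injEq]
    by_cases a1 : ιA p.1.1 = w1 <;> by_cases a2 : ιA p.1.2.1 = w2 <;>
      by_cases a3 : ιA p.1.2.2 = w3 <;> by_cases b1 : ιB p.2.1 = v1 <;>
      by_cases b2 : ιB p.2.2.1 = v2 <;> by_cases b3 : ιB p.2.2.2 = v3 <;>
      simp [a1, a2, a3, b1, b2, b3, eq_comm (a := v1), eq_comm (a := v2), eq_comm (a := v3),
        eq_comm (a := w1), eq_comm (a := w2), eq_comm (a := w3)]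
    ring
  calc _ = ∑ p : (κ × κ × κ) × (κ × κ × κ), ∑ q : (Fin (2 ^ n) × Fin (2 ^ n) × Fin (2 ^ n)) ×
      (Fin (2 ^ n) × Fin (2 ^ n) × Fin (2 ^ n)),
        ((g p.1 * h p.2 : ℝ) : ℂ) * ((φ q.1 * φ q.2 : ℝ) : ℂ) *
        (if q = ((ιB p.2.1, ιB p.2.2.1, ιB p.2.2.2), (ιA p.1.1, ιA p.1.2.1, ιA p.1.2.2))
        then ((2 : ℂ) ^ n) ^ 3 else 0) := by
        refine Finset.sum_congr rfl fun p _ => ?_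
        rw [Finset.sum_comm]
        refine Finset.sum_congr rfl fun q _ => ?_
        rw [← h1, Finset.mul_sum]
        exact Finset.sum_congr rfl fun z _ => by ring
    _ = ∑ p : (κ × κ × κ) × (κ × κ × κ), ((g p.1 * h p.2 : ℝ) : ℂ) *
        ((φ (ιB p.2.1, ιB p.2.2.1, ιB p.2.2.2) * φ (ιA p.1.1, ιA p.1.2.1, ιA p.1.2.2) : ℝ) : ℂ) *
          ((2 : ℂ) ^ n) ^ 3 := by
        refine Finset.sum_congr rfl fun p _ => ?_
        simp only [mul_ite, mul_zero, Finset.sum_ite_eq', Finset.mem_univ, if_true]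
    _ = _ := by
        rw [Fintype.sum_prod_type]
        push_cast
        rw [Finset.mul_sum]
        refine Finset.sum_congr rfl fun x _ => ?_
        rw [Finset.mul_sum]
        exact Finset.sum_congr rfl fun y _ => by ring

end pauliForm

/-! ### The state, the constants and the theorem -/

theorem log_factor_le {n : ℝ} (hn : 0 < n) :
    (n * Real.log 2) ^ (-(5 / 2) : ℝ) * (n * √(2 * n) ^ 3) ≤ 16 := by
  have hlog : (1 / 2 : ℝ) ≤ Real.log 2 := by linarith [Real.log_two_gt_d9]
  -- This x removes the roots: √(2n) = 2x, and n log 2 ≥ x² since log 2 ≥ 1/2.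
  set x := √(n / 2) with hx
  have hx0 : 0 < x := by positivity
  have hx2 : x ^ 2 = n / 2 := Real.sq_sqrt (by positivity)
  have h1 : (n * Real.log 2) ^ (-(5 / 2) : ℝ) ≤ (x ^ 5)⁻¹ := by
    calc _ ≤ (x ^ 2) ^ (-(5 / 2) : ℝ) := by
          refine Real.rpow_le_rpow_of_nonpos (by positivity) ?_ (by norm_num)
          rw [hx2]; nlinarith
      _ = (x ^ 5)⁻¹ := by
          rw [← Real.rpow_natCast, ← Real.rpow_mul hx0.le, ← Real.rpow_natCast x 5,
            ← Real.rpow_neg hx0.le]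
          norm_num
  have h2 : √(2 * n) = 2 * x := by
    rw [show 2 * n = (2 * x) ^ 2 by rw [mul_pow, hx2]; ring, Real.sqrt_sq (by positivity)]
  have h3 : n = 2 * x ^ 2 := by rw [hx2]; ring
  calc _ ≤ (x ^ 5)⁻¹ * (n * √(2 * n) ^ 3) := by gcongr
    _ = (x ^ 5)⁻¹ * (2 * x ^ 2 * (2 * x) ^ 3) := by rw [h2, ← h3]
    _ = 16 := by field_simp; norm_num
    _ ≤ 16 := le_rfl

/-- A real unit vector that is proportional to `g` and `h` on two disjoint blocks. -/
theorem exists_unit_vector_on_blocks {κ ν : Type*} [Fintype κ] [Fintype ν] [Nonempty κ]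
    {g h : κ × κ × κ → ℝ} (hg : ∀ j, g j = 1 ∨ g j = -1) (hh : ∀ j, h j = 1 ∨ h j = -1)
    {ιA ιB : κ → ν} (hA : Function.Injective ιA) (hB : Function.Injective ιB)
    (hAB : ∀ i j, ιA i ≠ ιB j) :
    ∃ φ : ν × ν × ν → ℝ, ∑ v, φ v ^ 2 = 1 ∧
      (∑ x, g x * φ (ιA x.1, ιA x.2.1, ιA x.2.2)) * (∑ y, h y * φ (ιB y.1, ιB y.2.1, ιB y.2.2)) =
        (Fintype.card κ : ℝ) ^ 3 / 2 := by
  let ι : (κ × κ × κ) ⊕ (κ × κ × κ) → ν × ν × ν :=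
    Sum.elim (fun x => (ιA x.1, ιA x.2.1, ιA x.2.2)) (fun y => (ιB y.1, ιB y.2.1, ιB y.2.2))
  have hι : Function.Injective ι := by
    rintro (⟨x1, x2, x3⟩ | ⟨x1, x2, x3⟩) (⟨y1, y2, y3⟩ | ⟨y1, y2, y3⟩) hxy <;>
      simp only [ι, Sum.elim_inl, Sum.elim_inr, Prod.mk.injEq] at hxy
    · rw [hA hxy.1, hA hxy.2.1, hA hxy.2.2]
    · exact absurd hxy.1 (hAB _ _)
    · exact absurd hxy.1.symm (hAB _ _)
    · rw [hB hxy.1, hB hxy.2.1, hB hxy.2.2]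
  set M : ℝ := (Fintype.card κ : ℝ) ^ 3 with hM
  have hM0 : 0 < M := by
    have : 0 < Fintype.card κ := Fintype.card_pos
    positivity
  -- The vector has 2M nonzero entries, all ±α. Disjoint blocks let one vector carry both g and h.
  set α : ℝ := (√(2 * M))⁻¹ with hα
  have hα2 : α ^ 2 = (2 * M)⁻¹ := by rw [hα, inv_pow, Real.sq_sqrt (by positivity)]
  let φ : ν × ν × ν → ℝ := Function.extend ι (fun z => α * Sum.elim g h z) 0
  have hφ : ∀ z, φ (ι z) = α * Sum.elim g h z := fun z => hι.extend_apply _ _ z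
  have hcard : ∑ _x : κ × κ × κ, (1 : ℝ) = M := by
    rw [Finset.sum_const, Finset.card_univ, Fintype.card_prod, Fintype.card_prod, nsmul_eq_mul, hM]
    push_cast
    ring
  have hsq : ∀ {a : ℝ}, a = 1 ∨ a = -1 → a * a = 1 := by
    rintro a (rfl | rfl) <;> norm_num
  refine ⟨φ, ?_, ?_⟩
  · rw [← Fintype.sum_of_injective ι hι (fun z => (α * Sum.elim g h z) ^ 2) (fun v => φ v ^ 2)
      (fun v hv => by
        have : φ v = 0 := Function.extend_apply' _ _ _ fun ⟨z, hz⟩ => hv ⟨z, hz⟩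
        rw [this]; norm_num) (fun z => by rw [hφ])]
    rw [Fintype.sum_sum_type]
    simp only [Sum.elim_inl, Sum.elim_inr, mul_pow, hα2]
    have h1 : ∑ x, (2 * M)⁻¹ * g x ^ 2 = (2 * M)⁻¹ * M := by
      rw [← Finset.mul_sum, ← hcard]
      congr 1
      exact Finset.sum_congr rfl fun x _ => by rw [sq, hsq (hg x)]
    have h2 : ∑ x, (2 * M)⁻¹ * h x ^ 2 = (2 * M)⁻¹ * M := by
      rw [← Finset.mul_sum, ← hcard]
      congr 1
      exact Finset.sum_congr rfl fun x _ => by rw [sq, hsq (hh x)]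
    rw [h1, h2]
    field_simp
    norm_num
  · have h1 : ∑ x, g x * φ (ιA x.1, ιA x.2.1, ιA x.2.2) = α * M := by
      rw [← hcard, Finset.mul_sum]
      refine Finset.sum_congr rfl fun x _ => ?_
      have : φ (ιA x.1, ιA x.2.1, ιA x.2.2) = α * g x := hφ (Sum.inl x)
      rw [this]
      linear_combination α * hsq (hg x)
    have h2 : ∑ y, h y * φ (ιB y.1, ιB y.2.1, ιB y.2.2) = α * M := by
      rw [← hcard, Finset.mul_sum]
      refine Finset.sum_congr rfl fun x _ => ?_
      have : φ (ιB x.1, ιB x.2.1, ιB x.2.2) = α * h x := hφ (Sum.inr x)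
      rw [this]
      linear_combination α * hsq (hh x)
    rw [h1, h2]
    calc α * M * (α * M) = α ^ 2 * (M * M) := by ring
      _ = M / 2 := by rw [hα2]; field_simp

theorem ratio_le {n K N T b : ℝ} (hn : 0 < n) (hK : 0 < K) (hT : 0 < T) (hN : N = 2 * K)
    (hlog : Real.log N = n * Real.log 2)
    (hb : b ≤ 4 * (2 * (46080 * K * (24 * n) * √(2 * n) ^ 3)) * (N * √N) ^ 3 / T) :
    1 / (512 * (2 * 46080 * 24)) * (√N * Real.log N ^ (-(5 / 2) : ℝ)) * b ≤
      N ^ 3 * (K ^ 3 / 2) / T := by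
  have hl2 : 0 < Real.log 2 := Real.log_pos (by norm_num)
  have hN0 : 0 < N := by rw [hN]; positivity
  rw [hlog]
  have hfac := log_factor_le hn
  have hl0 : 0 ≤ (n * Real.log 2) ^ (-(5 / 2) : ℝ) := by positivity
  generalize (n * Real.log 2) ^ (-(5 / 2) : ℝ) = l at hfac hl0 ⊢
  calc _ ≤ 1 / (512 * (2 * 46080 * 24)) * (√N * l) *
        (4 * (2 * (46080 * K * (24 * n) * √(2 * n) ^ 3)) * (N * √N) ^ 3 / T) := by gcongr
    _ = 4 / 512 * (K * (l * (n * √(2 * n) ^ 3))) * (√N * √N) ^ 2 * N ^ 3 / T := by ring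
    _ ≤ 4 / 512 * (K * 16) * (√N * √N) ^ 2 * N ^ 3 / T := by gcongr
    -- The 512 is fitted here: 4 · 16/512 = 1/8, and N² = 4K² turns K N²/8 into K³/2.
    _ = N ^ 3 * (K ^ 3 / 2) / T := by
      rw [Real.mul_self_sqrt hN0.le, hN]
      ring

theorem theorem1 :
    ∃ C : ℝ, 0 < C ∧ ∀ n : ℕ, 1 ≤ n →
      ∃ G : XORGame ((2 ^ n) ^ 2),
        C * (√((2 ^ n : ℕ) : ℝ) * Real.log ((2 ^ n : ℕ) : ℝ) ^ (-(5 / 2) : ℝ)) * G.classicalBias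
            ≤ G.entangledBias ∧
        ∃ S : EntangledStrategy ((2 ^ n) ^ 2) (2 ^ n),
          C * (√((2 ^ n : ℕ) : ℝ) * Real.log ((2 ^ n : ℕ) : ℝ) ^ (-(5 / 2) : ℝ)) * G.classicalBias
              ≤ G.entangledValue S ∧
          ∀ q, S.obs₁ q ∈ pauliStrings n ∧ S.obs₂ q ∈ pauliStrings n ∧
            S.obs₃ q ∈ pauliStrings n := by
  refine ⟨1 / (512 * (2 * 46080 * 24)), by norm_num, fun n hn => ?_⟩
  -- With K = 2^m the number m + 1 of dyadic scales is exactly n.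
  obtain ⟨m, rfl⟩ : ∃ m, n = m + 1 := ⟨n - 1, by omega⟩
  set n := m + 1 with hn_def
  obtain ⟨K, hK⟩ : ∃ K : ℕ, K = 2 ^ m := ⟨_, rfl⟩
  have hNK : 2 ^ n = 2 * K := by rw [hK, hn_def, pow_succ, mul_comm]
  have hK0 : 0 < K := by rw [hK]; positivity
  have : Nonempty (Fin K) := ⟨⟨0, hK0⟩⟩
  obtain ⟨g, h, hg, hh, hgh⟩ := exists_sign_tensors_froNorm_le m hK
  let ιA : Fin K → Fin (2 ^ n) := fun i => ⟨i, by omega⟩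
  let ιB : Fin K → Fin (2 ^ n) := fun i => ⟨K + i, by omega⟩
  have hA : Function.Injective ιA := fun i j hij => Fin.ext (by simpa [ιA] using hij)
  have hB : Function.Injective ιB := fun i j hij => Fin.ext (by simpa [ιB] using hij)
  have hAB : ∀ i j, ιA i ≠ ιB j := fun i j hij => by
    have : (i : ℕ) = K + j := congrArg Fin.val hij
    omega
  obtain ⟨φ, hφ1, hφ2⟩ := exists_unit_vector_on_blocks hg hh hA hB hAB
  rw [Fintype.card_fin] at hφ2
  have hQ : Fintype.card (Fin n → Fin 4) = (2 ^ n) ^ 2 := by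
    rw [Fintype.card_fun, Fintype.card_fin, Fintype.card_fin, ← pow_mul, mul_comm, pow_mul]
    norm_num
  let e : Fin ((2 ^ n) ^ 2) ≃ (Fin n → Fin 4) := (Fintype.equivFinOfCardEq hQ).symm
  let z₀ : (Fin n → Fin 4) × (Fin n → Fin 4) × (Fin n → Fin 4) → ℂ := fun z =>
    cForm g h ιA ιB (pauliString z.1) (pauliString z.2.1) (pauliString z.2.2)
  let c : Fin ((2 ^ n) ^ 2) → Fin ((2 ^ n) ^ 2) → Fin ((2 ^ n) ^ 2) → ℝ := fun i j k =>
    (z₀ (e i, e j, e k)).re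
  let S : EntangledStrategy ((2 ^ n) ^ 2) (2 ^ n) :=
    { state := WithLp.toLp 2 fun v => (φ v : ℂ)
      norm_state := by
        rw [← sq_eq_sq₀ (norm_nonneg _) zero_le_one, EuclideanSpace.norm_sq_eq, one_pow, ← hφ1]
        exact Finset.sum_congr rfl fun v _ => by simp
      obs₁ := fun q => pauliString (e q)
      obs₂ := fun q => pauliString (e q)
      obs₃ := fun q => pauliString (e q)
      isObservable₁ := fun q => pauliString_isObservable _
      isObservable₂ := fun q => pauliString_isObservable _
      isObservable₃ := fun q => pauliString_isObservable _ }
  set N : ℝ := 2 ^ n with hN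
  have hN0 : 0 < N := by positivity
  have hsum : ∑ i, ∑ j, ∑ k, c i j k * S.correlation i j k = N ^ 3 * ((K : ℝ) ^ 3 / 2) := by
    have h1 := congrArg Complex.re (sum_cForm_mul_expectation g h ιA ιB φ)
    rw [Complex.ofReal_re, hφ2, Complex.re_sum] at h1
    rw [← h1]
    refine Eq.trans ?_ (sum_equiv_triple e _)
    refine Finset.sum_congr rfl fun i _ => Finset.sum_congr rfl fun j _ =>
      Finset.sum_congr rfl fun k _ => ?_
    -- Expectations of Hermitian operators are real, so keeping only the real part of the form in
    -- the coefficients does not change the real part of the score.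
    have hH : (pauliString (e i) ⊗ₖ (pauliString (e j) ⊗ₖ pauliString (e k))).IsHermitian := by
      rw [Matrix.IsHermitian, Matrix.conjTranspose_kronecker, Matrix.conjTranspose_kronecker,
        pauliString_isHermitian, pauliString_isHermitian, pauliString_isHermitian]
    have him := hH.im_star_dotProduct_mulVec_self (fun v => (φ v : ℂ))
    rw [Complex.mul_re]
    have him' : (star (fun v => (φ v : ℂ)) ⬝ᵥ ((pauliString (e i) ⊗ₖ (pauliString (e j) ⊗ₖ
      pauliString (e k))) *ᵥ fun v => (φ v : ℂ))).im = 0 := him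
    rw [him', mul_zero, sub_zero]
    rfl
  have hKpos : (0 : ℝ) < K := by exact_mod_cast hK0
  -- The positive entangled score itself shows that the weights do not all vanish.
  have hc : 0 < ∑ i, ∑ j, ∑ k, |c i j k| := by
    refine lt_of_lt_of_le ?_ (XORGame.sum_mul_correlation_le c S)
    rw [hsum]
    positivity
  set T : ℝ := ∑ i, ∑ j, ∑ k, |c i j k| with hT
  set G := XORGame.ofCoeff c hc with hG
  set β : ℝ := 2 * (46080 * K * (24 * (m + 1 : ℕ)) * √(2 * (m + 1 : ℕ)) ^ 3) with hβ
  have hβ0 : 0 ≤ β := by positivity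
  set f : ℝ := N * √N with hf
  have hf2 : f ^ 2 = N ^ 3 := by
    rw [hf, mul_pow, Real.sq_sqrt hN0.le]; ring
  have hbias : G.classicalBias ≤ 4 * β * f ^ 3 / T := by
    refine ciSup_le fun ⟨χ, υ, ζ⟩ => ?_
    rw [hG, XORGame.ofCoeff_classicalValue, ← hT]
    refine div_le_div_of_nonneg_right ?_ hc.le
    let r : (Fin ((2 ^ n) ^ 2) → ℤˣ) → (Fin n → Fin 4) → ℝ := fun χ s => ((χ (e.symm s) : ℤ) : ℝ)
    have hr : ∀ χ s, r χ s ^ 2 = 1 := by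
      intro χ s
      simp only [r]
      rcases Int.units_eq_one_or (χ (e.symm s)) with h | h <;> rw [h] <;> norm_num
    have hX : ∀ χ : Fin ((2 ^ n) ^ 2) → ℤˣ, ∑ x, ∑ y, Complex.normSq
        ((Matrix.of fun x y => ∑ s, (r χ s : ℂ) * pauliString s x y :
          Matrix (Fin (2 ^ n)) (Fin (2 ^ n)) ℂ) x y) ≤ f ^ 2 := by
      intro χ
      rw [hf2]
      exact (sum_normSq_sum_smul_pauliString (r χ) (hr χ)).le
    refine le_trans (le_of_eq ?_)
      (re_cForm_le g h hA hB hβ0 (by positivity) hgh (hX χ) (hX υ) (hX ζ))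
    rw [cForm_sum, Complex.re_sum]
    refine Eq.trans ?_ (sum_equiv_triple e _)
    refine Finset.sum_congr rfl fun i _ => Finset.sum_congr rfl fun j _ =>
      Finset.sum_congr rfl fun k _ => ?_
    have hre : ∀ (a b c : ℝ) (z : ℂ), ((a : ℂ) * b * c * z).re = z.re * (a * b * c) := by
      intro a b c z
      rw [← Complex.ofReal_mul, ← Complex.ofReal_mul, Complex.re_ofReal_mul, mul_comm]
    rw [hre]
    simp only [r, Equiv.symm_apply_apply, c, z₀]
  have hcast : ((2 ^ n : ℕ) : ℝ) = N := by rw [hN]; push_cast; rfl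
  have hmain : 1 / (512 * (2 * 46080 * 24)) *
      (√((2 ^ n : ℕ) : ℝ) * Real.log ((2 ^ n : ℕ) : ℝ) ^ (-(5 / 2) : ℝ)) *
      G.classicalBias ≤ G.entangledValue S := by
    have hval : G.entangledValue S = N ^ 3 * ((K : ℝ) ^ 3 / 2) / T := by
      rw [hG, XORGame.ofCoeff_entangledValue, hsum]
    rw [hcast, hval]
    exact ratio_le (n := ((m + 1 : ℕ) : ℝ)) (by positivity) hKpos hc
      (by rw [← hcast, hNK]; push_cast; ring) (by rw [hN, Real.log_pow]) hbias
  refine ⟨G, hmain.trans (G.entangledValue_le_entangledBias S), S, hmain, fun q => ?_⟩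
  exact ⟨⟨e q, rfl⟩, ⟨e q, rfl⟩, ⟨e q, rfl⟩⟩
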